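/- Let $n\ge 1$, $N=2^n$, $a<b$, and $\bar x:=(b-a)x/N+a$ for $x\in\{0,\dots,N-1\}$. For a bounded function $g\colon[a,b]\to\mathbb C$ that does not vanish at all grid points $\bar x$, write $|g|_{\max}:=\sup_{t\in[a,b]}|g(t)|$, $$|\Psi_g\rangle:=\Big(\sum_{x=0}^{N-1}|g(\bar x)|^2\Big)^{-1/2}\sum_{x=0}^{N-1}g(\bar x)\,|x\rangle,\qquad \mathcal F_g^{[N]}:=\frac{\sqrt{\frac{b-a}{N}\sum_{x=0}^{N-1}|g(\bar x)|^2}}{\sqrt{(b-a)\,|g|_{\max}^2}}$$ (the state with amplitudes proportional to $g$, and the discretized $L^2$-norm filling fraction of $g$). There is an absolute constant $C>0$ such that the following holds. Let $f\colon[a,b]\to\mathbb C$ be bounded and not zero at all grid points, let $d\ge1$ and let $P\in\mathbb C[y]$ be a polynomial of degree at most $d$. Put $\tilde f(t):=P\big(\sin\tfrac{t-a}{b-a}\big)$ for $t\in[a,b]$, so that $\tilde f(\bar x)=P(\sin(x/N))$. Let $\varepsilon\ge0$ and suppose that $$\Big|P(\sin(x/N))-\frac{f(\bar x)}{|f|_{\max}}\Big|\le\delta:=\varepsilon\cdot\min\big(\mathcal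 F_f^{[N]},\mathcal F_{\tilde f}^{[N]}\big)\qquad\text{for all }x\in\{0,\dots,N-1\}$$ (if $\tilde f$ vanishes at all grid points, read $\mathcal F_{\tilde f}^{[N]}:=0$; the hypothesis then fails). Let $K$ be such that $|P(y)|\le K\,|\tilde f|_{\max}=K\max_{z\in[0,\sin 1]}|P(z)|$ for all $y\in[-1,1]$ (the case $K=1$ being the normalization required by the quantum eigenvalue transformation). Then: 1. $|\Psi_{\tilde f}\rangle$ is $\varepsilon$-close to $|\Psi_f\rangle$ in trace distance, i.e. $\tfrac12\big\||\Psi_{\tilde f}\rangle\langle\Psi_{\tilde f}|-|\Psi_f\rangle\langle\Psi_f|\big\|_1\le\varepsilon$; 2. $|\Psi_{\tilde f}\rangle$ can be prepared exactly with $4$ ancilla qubits: there is a circuit on $n+4$ qubits that maps $|0\rangle^{\otimes n}|0\rangle^{\otimes4}$ to $|\Psi_{\tilde f}\rangle|0\rangle^{\otimes4}$ and consists of at most $C\cdot K\cdot n\,d\,/\,\mathcal F_{\tilde f}^{[N]}$ single-qubit unitary gates and CNOT gates. In particular, $O\big(n\,d/\mathcal F_{\tilde f}^{[N]}\big)$ gates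 suffice whenever $K=O(1)$. -/

import Mathlib

noncomputable section

namespace QPrep

/-! ### Quantum circuits

Qubits are labelled by a finite type `ι`; computational basis states are bit strings `ι → Fin 2` and
(unnormalised) state vectors are functions `(ι → Fin 2) → ℂ`. -/

/-- State vectors of a register of qubits labelled by `ι`. -/
abbrev StateVec (ι : Type) : Type := (ι → Fin 2) → ℂ

/-- The computational basis vector `|s⟩`. -/
def ket {ι : Type} [Fintype ι] [DecidableEq ι] (s : ι → Fin 2) : StateVec ι :=
  Pi.single s 1

/-- Elementary gates: arbitrary single-qubit unitaries and CNOT gates. -/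
inductive Gate (ι : Type) : Type
  | single (q : ι) (U : Matrix.unitaryGroup (Fin 2) ℂ) : Gate ι
  | cnot (control target : ι) (hne : control ≠ target) : Gate ι

/-- Action of a gate on state vectors. -/
def Gate.apply {ι : Type} [DecidableEq ι] : Gate ι → StateVec ι → StateVec ι
  | .single q U, ψ => fun s => ∑ j : Fin 2, (U : Matrix (Fin 2) (Fin 2) ℂ) (s q) j *
      ψ (Function.update s q j)
  | .cnot c t _, ψ => fun s => ψ (Function.update s t (s t + s c))

/-- A circuit is a list of gates, the head of the list being applied first. Its gate count is the
length of the list. -/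
abbrev Circuit (ι : Type) : Type := List (Gate ι)

/-- The state vector obtained by running a circuit. -/
def Circuit.run {ι : Type} [DecidableEq ι] (c : Circuit ι) (ψ : StateVec ι) : StateVec ι :=
  c.foldl (fun φ g => g.apply φ) ψ

/-- The bit string of `|x⟩|0⟩^{⊗k}`: the `n` data qubits hold the binary digits of `x`, the `k`
ancilla qubits are all `0`. -/
def basisBits (n k : ℕ) (x : Fin (2 ^ n)) : Fin n ⊕ Fin k → Fin 2 :=
  Sum.elim (finFunctionFinEquiv.symm x) (fun _ => 0)

/-- The state `|ψ⟩|0⟩^{⊗k} = ∑ₓ ψₓ |x⟩|0⟩^{⊗k}`. -/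
def withAncillas {n : ℕ} (k : ℕ) (ψ : Fin (2 ^ n) → ℂ) : StateVec (Fin n ⊕ Fin k) :=
  ∑ x, ψ x • ket (basisBits n k x)

/-! ### Trace distance -/

/-- The trace norm (Schatten 1-norm): the sum of the singular values, that is, of the square roots
of the eigenvalues of `Aᴴ A`. -/
def traceNorm {ι : Type} [Fintype ι] [DecidableEq ι] (A : Matrix ι ι ℂ) : ℝ :=
  ∑ i, √((Matrix.isHermitian_conjTranspose_mul_self A).eigenvalues i)

/-- Trace distance `½ ‖ |ψ⟩⟨ψ| - |φ⟩⟨φ| ‖₁` of two pure states. -/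
def traceDist {ι : Type} [Fintype ι] [DecidableEq ι] (ψ φ : ι → ℂ) : ℝ :=
  traceNorm (Matrix.vecMulVec ψ (star ψ) - Matrix.vecMulVec φ (star φ)) / 2

/-! ### Discretised functions -/

/-- The grid point `x̄ = (b - a) x / N + a` with `N = 2 ^ n`. -/
def gridPoint (a b : ℝ) (n : ℕ) (x : Fin (2 ^ n)) : ℝ :=
  (b - a) * ((x : ℕ) : ℝ) / 2 ^ n + a

/-- The supremum of `|f|` over `[a, b]`. -/
def supAbs (f : ℝ → ℂ) (a b : ℝ) : ℝ :=
  sSup ((fun t => ‖f t‖) '' Set.Icc a b)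

/-- The normalised state vector `|Ψ_f⟩` with amplitudes proportional to `f (x̄)`. -/
def stateOf (f : ℝ → ℂ) (a b : ℝ) (n : ℕ) : Fin (2 ^ n) → ℂ :=
  fun x => f (gridPoint a b n x) /
    ((√(∑ z : Fin (2 ^ n), ‖f (gridPoint a b n z)‖ ^ 2) : ℝ) : ℂ)

/-- The discretised 2-norm `√((b - a) / N * ∑ₓ |f (x̄)|²)`. -/
def discNorm (f : ℝ → ℂ) (a b : ℝ) (n : ℕ) : ℝ :=
  √((b - a) / 2 ^ n * ∑ x : Fin (2 ^ n), ‖f (gridPoint a b n x)‖ ^ 2)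

/-- The discretised L2-norm filling fraction of `f` on `[a, b]`. -/
def fillFrac (f : ℝ → ℂ) (a b : ℝ) (n : ℕ) : ℝ :=
  discNorm f a b n / √((b - a) * supAbs f a b ^ 2)

/-- The function on `[a, b]` implemented by the polynomial `P`: `P` applied to
`sin ((t - a) / (b - a))`, whose value at the grid point `x̄` is `P (sin (x / N))`. -/
def polySin (P : Polynomial ℂ) (a b : ℝ) : ℝ → ℂ :=
  fun t => P.eval ((Real.sin ((t - a) / (b - a)) : ℝ) : ℂ)

theorem polySin_gridPoint (P : Polynomial ℂ) {a b : ℝ} (hab : a < b) (n : ℕ) (x : Fin (2 ^ n)) :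
    polySin P a b (gridPoint a b n x) = P.eval ((Real.sin (((x : ℕ) : ℝ) / 2 ^ n) : ℝ) : ℂ) := by
  have h : b - a ≠ 0 := sub_ne_zero.mpr hab.ne'
  have h2 : ((b - a) * ((x : ℕ) : ℝ) / 2 ^ n + a - a) / (b - a) = ((x : ℕ) : ℝ) / 2 ^ n := by
    field_simp
    ring
  simp only [polySin, gridPoint, h2]

end QPrep

end

/-!
The trace distance bound is plane geometry. The rescaled vector of values of `f` differs from the
vector of values of `P (sin (x / N))` by at most `ε` times its own norm, so its component orthogonal
to the latter has relative length at most `ε`. This relative length bounds the trace distance, since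
the difference of the two projections has rank at most two (`traceNorm_le_of_rank_le_two`,
`traceDist_le`, `one_sub_normSq_le`).

The circuit rests on three constructions.

* Generalised quantum signal processing. With `z = exp (ix / N)`, the amplitude `P (sin (x / N))` is
  `z ^ (-d)` times a polynomial `Q` of degree at most `2d` in `z`. If `|Q| < 1` on the unit circle,
  the Fejér–Riesz theorem supplies a polynomial `R` with `|Q| ^ 2 + |R| ^ 2 = 1` there
  (`exists_complement`). The extreme coefficient vectors of the pair `(Q, R)` are then orthogonal,
  so that a constant unitary makes `Q` divisible by `z` and lowers the degree of `R`
  (`exists_layer`). Hence one ancilla and `2d` layers `diag (z, 1)` produce the amplitudes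
  (`exists_signalProcessing`). Each layer is a product of `n` controlled phases, one for each binary
  digit of `x`. No parity or reality assumption on `P` is needed.
* Exact amplitude amplification (`exists_amplification`). Multiplying `P` by a constant sets the
  initial success amplitude to `sin (π / (2 (2m + 1)))`, and then `m` rounds reach success
  probability one. As the largest possible success amplitude is the filling fraction divided by `K`,
  a number `m` of the order of `K` over the filling fraction suffices (`exists_preparation`).
* A reflection in linearly many gates (`exists_reflection`). The conjunction of `n` bits is computed
  by ladders of Toffoli gates whose intermediate targets are borrowed from the register itself: each
  half of the data qubits serves as work space for the other half.

The four ancillas are the signal qubit `inr 0`, the two targets `inr 1` and `inr 2` of the ladders,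
and `inr 3`, an additional control that keeps the ladders nonempty.
-/

noncomputable section

set_option linter.unusedSectionVars false

namespace QPrep

/-! ### Circuits as unitary operators -/

section Circuits

variable {ι : Type} [DecidableEq ι]

theorem fin_two_cases (k : Fin 2) : k = 0 ∨ k = 1 := by omega

/-- The only qubit whose value a gate can change. -/
def Gate.target : Gate ι → ι
  | .single q _ => q
  | .cnot _ t _ => t

/-- The inverse gate. -/
def Gate.inv : Gate ι → Gate ι
  | .single q U => .single q U⁻¹
  | .cnot c t h => .cnot c t h

/-- The inverse circuit: the inverse gates in reverse order. -/
def Circuit.inv (c : Circuit ι) : Circuit ι := (c.map Gate.inv).reverse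

theorem Circuit.run_nil (ψ : StateVec ι) : Circuit.run ([] : Circuit ι) ψ = ψ := rfl

theorem Circuit.run_cons (g : Gate ι) (c : Circuit ι) (ψ : StateVec ι) :
    Circuit.run (g :: c) ψ = Circuit.run c (g.apply ψ) := rfl

theorem Circuit.run_append (c c' : Circuit ι) (ψ : StateVec ι) :
    Circuit.run (c ++ c') ψ = Circuit.run c' (Circuit.run c ψ) := by
  simp [Circuit.run]

theorem Circuit.length_inv (c : Circuit ι) : (Circuit.inv c).length = c.length := by
  simp [Circuit.inv]

theorem Gate.apply_add (g : Gate ι) (ψ φ : StateVec ι) :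
    g.apply (ψ + φ) = g.apply ψ + g.apply φ := by
  cases g <;> funext s <;> simp [Gate.apply]; ring

theorem Gate.apply_smul (g : Gate ι) (k : ℂ) (ψ : StateVec ι) :
    g.apply (k • ψ) = k • g.apply ψ := by
  cases g <;> funext s <;> simp [Gate.apply]; ring

theorem Circuit.run_add (c : Circuit ι) (ψ φ : StateVec ι) :
    Circuit.run c (ψ + φ) = Circuit.run c ψ + Circuit.run c φ := by
  induction c generalizing ψ φ with
  | nil => rfl
  | cons g c ih => simp only [Circuit.run_cons, Gate.apply_add, ih]

theorem Circuit.run_smul (c : Circuit ι) (k : ℂ) (ψ : StateVec ι) :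
    Circuit.run c (k • ψ) = k • Circuit.run c ψ := by
  induction c generalizing ψ with
  | nil => rfl
  | cons g c ih => simp only [Circuit.run_cons, Gate.apply_smul, ih]

theorem Gate.target_inv (g : Gate ι) : g.inv.target = g.target := by
  cases g <;> rfl

theorem Gate.apply_inv_apply (g : Gate ι) (ψ : StateVec ι) : g.inv.apply (g.apply ψ) = ψ := by
  cases g with
  | single q U =>
    funext s
    have h : (U⁻¹ : Matrix.unitaryGroup (Fin 2) ℂ).1 * U.1 = 1 := by
      rw [← Submonoid.coe_mul]; simp
    have h' : ∀ k, ∑ j, (U⁻¹ : Matrix.unitaryGroup (Fin 2) ℂ).1 (s q) j * U.1 j k =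
        (1 : Matrix (Fin 2) (Fin 2) ℂ) (s q) k := fun k => by rw [← h, Matrix.mul_apply]
    simp only [Gate.apply, Gate.inv, Function.update_self, Function.update_idem, Finset.mul_sum]
    rw [Finset.sum_comm]
    simp only [← mul_assoc, ← Finset.sum_mul, h', Matrix.one_apply, ite_mul, one_mul, zero_mul]
    simp
  | cnot c t h =>
    funext s
    have h2 : ∀ a b : Fin 2, a + b + b = a := by decide
    simp [Gate.apply, Gate.inv, Function.update_of_ne h, h2]

theorem Gate.inv_inv (g : Gate ι) : g.inv.inv = g := by
  cases g <;> simp [Gate.inv]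

theorem Gate.apply_apply_inv (g : Gate ι) (ψ : StateVec ι) : g.apply (g.inv.apply ψ) = ψ := by
  simpa [Gate.inv_inv] using g.inv.apply_inv_apply ψ

theorem Circuit.run_run_inv (c : Circuit ι) (ψ : StateVec ι) :
    Circuit.run c (Circuit.run (Circuit.inv c) ψ) = ψ := by
  induction c generalizing ψ with
  | nil => rfl
  | cons g c ih =>
    have : Circuit.inv (g :: c) = Circuit.inv c ++ [g.inv] := by simp [Circuit.inv]
    rw [this, Circuit.run_append, Circuit.run_cons, Circuit.run_cons, Circuit.run_nil,
      Gate.apply_apply_inv, ih]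

theorem Circuit.run_inv_run (c : Circuit ι) (ψ : StateVec ι) :
    Circuit.run (Circuit.inv c) (Circuit.run c ψ) = ψ := by
  have hi : Circuit.inv (Circuit.inv c) = c := by
    simp [Circuit.inv, List.map_reverse, Function.comp_def, Gate.inv_inv]
  simpa [hi] using Circuit.run_run_inv (Circuit.inv c) ψ

theorem Gate.dotProduct_apply [Fintype ι] (g : Gate ι) (ψ φ : StateVec ι) :
    star (g.apply ψ) ⬝ᵥ φ = star ψ ⬝ᵥ g.inv.apply φ := by
  cases g with
  | single q U =>
    simp only [dotProduct, Gate.apply, Gate.inv, Pi.star_apply, star_sum, star_mul',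
      Finset.sum_mul, Finset.mul_sum]
    rw [← Finset.sum_product', ← Finset.sum_product']
    -- the involution `(s, j) ↦ (s with bit q replaced by j, old bit q)` matches the terms
    refine Finset.sum_nbij' (fun p => (Function.update p.1 q p.2, p.1 q))
      (fun p => (Function.update p.1 q p.2, p.1 q)) (by simp) (by simp) (by simp) (by simp) ?_
    rintro ⟨s, j⟩ -
    simp only [Function.update_self, Function.update_idem, Function.update_eq_self,
      Matrix.UnitaryGroup.inv_apply, Matrix.star_apply]
    ring
  | cnot c t h =>
    have h2 : ∀ a b : Fin 2, a + b + b = a := by decide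
    simp only [dotProduct, Gate.apply, Gate.inv, Pi.star_apply]
    refine Finset.sum_nbij' (fun s => Function.update s t (s t + s c))
      (fun s => Function.update s t (s t + s c)) (by simp) (by simp) ?_ ?_ ?_
    all_goals simp [Function.update_of_ne h, h2]

theorem Circuit.dotProduct_run [Fintype ι] (c : Circuit ι) (ψ φ : StateVec ι) :
    star (Circuit.run c ψ) ⬝ᵥ φ = star ψ ⬝ᵥ Circuit.run (Circuit.inv c) φ := by
  induction c generalizing ψ with
  | nil => rfl
  | cons g c ih =>
    have : Circuit.inv (g :: c) = Circuit.inv c ++ [g.inv] := by simp [Circuit.inv]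
    rw [this, Circuit.run_append, Circuit.run_cons, ih, Gate.dotProduct_apply]
    rfl

/-- The amplitudes of `c⁻¹ φ` are the inner products of `φ` with the images of the basis
vectors. -/
theorem Circuit.run_inv_apply [Fintype ι] (c : Circuit ι) (φ : StateVec ι) (σ : ι → Fin 2) :
    Circuit.run (Circuit.inv c) φ σ = star (Circuit.run c (ket σ)) ⬝ᵥ φ := by
  rw [Circuit.dotProduct_run]
  simp [ket, dotProduct, Pi.single_apply]

/-- No gate of the circuit `c` acts on qubit `r`, except possibly as a control. -/
def Circuit.Avoids (c : Circuit ι) (r : ι) : Prop := ∀ g ∈ c, g.target ≠ r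

theorem Circuit.Avoids.append {c c' : Circuit ι} {r : ι} (h : Circuit.Avoids c r)
    (h' : Circuit.Avoids c' r) : Circuit.Avoids (c ++ c') r := by
  intro g hg
  rcases List.mem_append.1 hg with hg | hg
  exacts [h g hg, h' g hg]

theorem Circuit.Avoids.inv {c : Circuit ι} {r : ι} (h : Circuit.Avoids c r) :
    Circuit.Avoids (Circuit.inv c) r := by
  intro g hg
  simp only [Circuit.inv, List.mem_reverse, List.mem_map] at hg
  obtain ⟨g, hg, rfl⟩ := hg
  rw [Gate.target_inv]
  exact h g hg

theorem Circuit.Avoids.flatMap {α : Type} {l : List α} {c : α → Circuit ι} {r : ι}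
    (h : ∀ a ∈ l, Circuit.Avoids (c a) r) : Circuit.Avoids (l.flatMap c) r := by
  intro g hg
  obtain ⟨a, ha, hg⟩ := List.mem_flatMap.1 hg
  exact h a ha g hg

/-- A circuit that avoids `r` keeps qubit `r` in the state `|0⟩`. -/
theorem Circuit.Avoids.run_eq_zero {c : Circuit ι} {r : ι} (h : Circuit.Avoids c r)
    {ψ : StateVec ι} (hψ : ∀ s, s r ≠ 0 → ψ s = 0) : ∀ s, s r ≠ 0 → Circuit.run c ψ s = 0 := by
  induction c generalizing ψ with
  | nil => exact hψ
  | cons g c ih =>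
    refine ih (fun g' hg' => h g' (List.mem_cons_of_mem _ hg')) (fun s hs => ?_)
    have hg : g.target ≠ r := h g List.mem_cons_self
    cases g with
    | single q U =>
      refine Finset.sum_eq_zero fun j _ => ?_
      rw [hψ _ (by rwa [Function.update_of_ne (show r ≠ q from Ne.symm hg)]), mul_zero]
    | cnot c t ht => exact hψ _ (by rwa [Function.update_of_ne (show r ≠ t from Ne.symm hg)])

/-! ### Diagonal operators -/

/-- The circuit `c` acts as multiplication by the function `f` in the computational basis. -/
def Circuit.IsDiag (c : Circuit ι) (f : (ι → Fin 2) → ℂ) : Prop :=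
  ∀ ψ s, Circuit.run c ψ s = f s * ψ s

theorem Circuit.IsDiag.append {c c' : Circuit ι} {f f' : (ι → Fin 2) → ℂ}
    (h : Circuit.IsDiag c f) (h' : Circuit.IsDiag c' f') :
    Circuit.IsDiag (c ++ c') (fun s => f s * f' s) := by
  intro ψ s
  rw [Circuit.run_append, h', h]
  ring

theorem Circuit.IsDiag.flatMap {α : Type} (l : List α) {c : α → Circuit ι}
    {f : α → (ι → Fin 2) → ℂ} (h : ∀ a, Circuit.IsDiag (c a) (f a)) :
    Circuit.IsDiag (l.flatMap c) (fun s => (l.map fun a => f a s).prod) := by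
  induction l with
  | nil => intro ψ s; simp [Circuit.run_nil]
  | cons a l ih => simpa using (h a).append ih

/-- Conjugation of a circuit by a CNOT gate. -/
def cnotConj (a b : ι) (hab : a ≠ b) (c : Circuit ι) : Circuit ι :=
  .cnot a b hab :: (c ++ [.cnot a b hab])

theorem Circuit.IsDiag.cnotConj {a b : ι} (hab : a ≠ b) {c : Circuit ι} {f : (ι → Fin 2) → ℂ}
    (h : Circuit.IsDiag c f) :
    Circuit.IsDiag (cnotConj a b hab c) (fun s => f (Function.update s b (s b + s a))) := by
  intro ψ s
  have h2 : ∀ a b : Fin 2, a + b + b = a := by decide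
  rw [QPrep.cnotConj, Circuit.run_cons, Circuit.run_append, Circuit.run_cons, Circuit.run_nil]
  simp [Gate.apply, h _ _, Function.update_of_ne hab, h2]

/-- The gate `diag (ω₀, ω₁)` on qubit `q`. -/
def phase (q : ι) (ω₀ ω₁ : Circle) : Gate ι :=
  .single q ⟨Matrix.diagonal ![(ω₀ : ℂ), ω₁], by
    rw [Matrix.mem_unitaryGroup_iff', Matrix.star_eq_conjTranspose, Matrix.diagonal_conjTranspose,
      Matrix.diagonal_mul_diagonal, ← Matrix.diagonal_one]
    congr 1
    funext i
    fin_cases i <;> simp [← Complex.normSq_eq_conj_mul_self]⟩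

theorem isDiag_phase (q : ι) (ω₀ ω₁ : Circle) :
    Circuit.IsDiag [phase q ω₀ ω₁] (fun s => if s q = 0 then (ω₀ : ℂ) else ω₁) := by
  intro ψ s
  rw [Circuit.run_cons, Circuit.run_nil]
  simp only [phase, Gate.apply, Matrix.diagonal_apply, ite_mul, zero_mul]
  rw [Finset.sum_ite_eq]
  rw [if_pos (Finset.mem_univ _), Function.update_eq_self]
  rcases fin_two_cases (s q) with hq | hq <;> simp [hq]

/-- The diagonal circuit with the phase `e ^ (iα)` where qubit `q` is `0` and qubit `j` is `1`. Half
angles occur because `2xy = x + y - (x ⊕ y)` for bits `x`, `y`. -/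
def cphase (q j : ι) (hqj : q ≠ j) (α : ℝ) : Circuit ι :=
  [phase q (Circle.exp (α / 2)) 1] ++ ([phase j 1 (Circle.exp (α / 2))] ++
    cnotConj q j hqj [phase j (Circle.exp (α / 2))⁻¹ 1])

theorem length_cphase (q j : ι) (hqj : q ≠ j) (α : ℝ) : (cphase q j hqj α).length = 5 := rfl

theorem isDiag_cphase (q j : ι) (hqj : q ≠ j) (α : ℝ) :
    Circuit.IsDiag (cphase q j hqj α)
      (fun s => if s q = 0 then (if s j = 0 then 1 else (Circle.exp α : ℂ)) else 1) := by
  have := (isDiag_phase q (Circle.exp (α / 2)) 1).append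
    ((isDiag_phase j 1 (Circle.exp (α / 2))).append
      ((isDiag_phase j (Circle.exp (α / 2))⁻¹ 1).cnotConj hqj))
  intro ψ s
  rw [cphase, this]
  have hα : (Circle.exp α : ℂ) = (Circle.exp (α / 2) : ℂ) * (Circle.exp (α / 2) : ℂ) := by
    rw [← Circle.coe_mul, ← Circle.exp_add, add_halves]
  have h2 : (1 : Fin 2) + 1 = 0 := rfl
  congr 1
  rcases fin_two_cases (s q) with hq | hq <;> rcases fin_two_cases (s j) with hj | hj <;>
    simp [hq, hj, hα, h2]

theorem avoids_phase {q r : ι} (h : q ≠ r) (ω₀ ω₁ : Circle) :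
    Circuit.Avoids [phase q ω₀ ω₁] r := by
  simpa [Circuit.Avoids, phase, Gate.target] using h

theorem avoids_cphase {q j r : ι} (hqj : q ≠ j) (hq : q ≠ r) (hj : j ≠ r) (α : ℝ) :
    Circuit.Avoids (cphase q j hqj α) r := by
  simp [Circuit.Avoids, cphase, cnotConj, phase, Gate.target, hq, hj]

end Circuits

/-! ### Toffoli gates and multiply controlled phases -/

section Reflection

variable {ι : Type} [DecidableEq ι]

/-- The Hadamard gate on qubit `q`. -/
def hadamard (q : ι) : Gate ι :=
  .single q ⟨((√2 : ℝ) : ℂ)⁻¹ • !![1, 1; 1, -1], by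
    have h : ((√2 : ℝ) : ℂ)⁻¹ * ((√2 : ℝ) : ℂ)⁻¹ = 1 / 2 := by
      rw [← mul_inv, ← Complex.ofReal_mul, Real.mul_self_sqrt zero_le_two]
      norm_num
    rw [Matrix.mem_unitaryGroup_iff', Matrix.star_eq_conjTranspose]
    ext i j
    fin_cases i <;> fin_cases j <;>
      simp [Matrix.mul_apply, h] <;> norm_num⟩

theorem hadamard_apply (q : ι) (ψ : StateVec ι) (s : ι → Fin 2) :
    (hadamard q).apply ψ s = ((√2 : ℝ) : ℂ)⁻¹ * (ψ (Function.update s q 0) +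
      (if s q = 0 then 1 else -1) * ψ (Function.update s q 1)) := by
  rcases fin_two_cases (s q) with hq | hq <;> simp [hadamard, Gate.apply, hq] <;> ring

/-- The circuit `c` permutes the computational basis: it acts by precomposition with `τ`. -/
def Circuit.IsPerm (c : Circuit ι) (τ : (ι → Fin 2) → (ι → Fin 2)) : Prop :=
  ∀ ψ s, Circuit.run c ψ s = ψ (τ s)

theorem Circuit.IsPerm.append {c c' : Circuit ι} {τ τ' : (ι → Fin 2) → (ι → Fin 2)}
    (h : Circuit.IsPerm c τ) (h' : Circuit.IsPerm c' τ') :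
    Circuit.IsPerm (c ++ c') (fun s => τ (τ' s)) := by
  intro ψ s
  rw [Circuit.run_append, h', h]

/-- The phase `-1` where `c` is `0` and `b`, `d` are `1`, built from eighth roots of unity on the
parities of subsets of the three bits: for bits `x`, `y`, `z`,
`4xyz = x + y + z - (x ⊕ y) - (x ⊕ z) - (y ⊕ z) + (x ⊕ y ⊕ z)`. -/
theorem exists_ccz {c b d : ι} (hcb : c ≠ b) (hcd : c ≠ d) (hbd : b ≠ d) :
    ∃ C : Circuit ι, C.length = 17 ∧
      Circuit.IsDiag C (fun s => if s c = 0 ∧ s b = 1 ∧ s d = 1 then -1 else 1) := by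
  set ω : Circle := Circle.exp (Real.pi / 4) with hω
  refine ⟨_, ?_, fun ψ s => (((isDiag_phase c ω 1).append ((isDiag_phase b 1 ω).append
    (isDiag_phase d 1 ω))).append (((isDiag_phase b ω⁻¹ 1).cnotConj hcb).append
    (((isDiag_phase d ω⁻¹ 1).cnotConj hcd).append (((isDiag_phase d 1 ω⁻¹).cnotConj hbd).append
    (((isDiag_phase d ω 1).cnotConj hbd).cnotConj hcd)))) ψ s).trans ?_⟩
  · rfl
  have h4 : (ω : ℂ) ^ 4 = -1 := by
    rw [← Circle.coe_pow, hω, ← Circle.exp_nsmul, Circle.coe_exp]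
    convert Complex.exp_pi_mul_I using 2
    push_cast
    ring
  have h4' : (ω : ℂ) * (ω * ω) * ω = -1 := by rw [← h4]; ring
  have h0 : (ω : ℂ) ≠ 0 := Circle.coe_ne_zero _
  have h2 : (1 : Fin 2) + 1 = 0 := rfl
  congr 1
  rcases fin_two_cases (s c) with h | h <;> rcases fin_two_cases (s b) with h' | h' <;>
    rcases fin_two_cases (s d) with h'' | h'' <;>
    simp [h, h', h'', Function.update_of_ne hbd, h2, h0, h4'] <;> field_simp

/-- The Toffoli gate with target `d`, positive control `b` and negated control `c`. -/
theorem exists_toffoli {c b d : ι} (hcb : c ≠ b) (hcd : c ≠ d) (hbd : b ≠ d) :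
    ∃ C : Circuit ι, C.length = 19 ∧
      Circuit.IsPerm C (fun s => Function.update s d (s d + (1 + s c) * s b)) := by
  obtain ⟨C, hC, hD⟩ := exists_ccz hcb hcd hbd
  refine ⟨hadamard d :: (C ++ [hadamard d]), by simp [hC], fun ψ s => ?_⟩
  have h2 : ((√2 : ℝ) : ℂ)⁻¹ * ((√2 : ℝ) : ℂ)⁻¹ = 1 / 2 := by
    rw [← mul_inv, ← Complex.ofReal_mul, Real.mul_self_sqrt zero_le_two]
    norm_num
  have h11 : (1 : Fin 2) + 1 = 0 := rfl
  rw [Circuit.run_cons, Circuit.run_append, Circuit.run_cons, Circuit.run_nil, hadamard_apply,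
    hD, hD, hadamard_apply, hadamard_apply]
  generalize ((√2 : ℝ) : ℂ)⁻¹ = r at h2
  rcases fin_two_cases (s c) with h | h <;> rcases fin_two_cases (s b) with h' | h' <;>
    rcases fin_two_cases (s d) with h'' | h'' <;>
    simp [h, h', h'', Function.update_of_ne hcd, Function.update_of_ne hbd, h11] <;>
    first
    | linear_combination (2 * ψ (Function.update s d 0)) * h2
    | linear_combination (2 * ψ (Function.update s d 1)) * h2

/-- The product of the bit `b` with the negations of the controls of the ladder `l`. -/
def ladderVal (b : ι) : List (ι × ι) → (ι → Fin 2) → Fin 2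
  | [], s => s b
  | p :: l, s => (1 + s p.1) * ladderVal b l s

/-- The action on bit strings of a ladder `l` of (control, target) pairs over the base bit `b`:
every target is toggled by the product of the base with all negated controls from its own rung down
to the end of the list. -/
def ladderMap (b : ι) : List (ι × ι) → (ι → Fin 2) → (ι → Fin 2)
  | [], s => s
  | p :: l, s => Function.update (ladderMap b l s) p.2 (s p.2 + ladderVal b (p :: l) s)

/-- Base, controls and targets of the ladder are separate qubits, and the targets are distinct.
(The controls may repeat.) -/
structure IsLadder (b : ι) (l : List (ι × ι)) : Prop where
  base_fst : b ∉ l.map Prod.fst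
  base_snd : b ∉ l.map Prod.snd
  nodup : (l.map Prod.snd).Nodup
  disjoint : ∀ c ∈ l.map Prod.fst, c ∉ l.map Prod.snd

theorem IsLadder.tail {b : ι} {p : ι × ι} {l : List (ι × ι)} (h : IsLadder b (p :: l)) :
    IsLadder b l where
  base_fst h' := h.base_fst (List.mem_cons_of_mem _ h')
  base_snd h' := h.base_snd (List.mem_cons_of_mem _ h')
  nodup := (List.nodup_cons.1 h.nodup).2
  disjoint c hc h' := h.disjoint c (List.mem_cons_of_mem _ hc) (List.mem_cons_of_mem _ h')

theorem ladderMap_of_notMem {b r : ι} {l : List (ι × ι)} (h : r ∉ l.map Prod.snd)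
    (s : ι → Fin 2) : ladderMap b l s r = s r := by
  induction l with
  | nil => rfl
  | cons p l ih =>
    simp only [List.map_cons, List.mem_cons, not_or] at h
    rw [ladderMap, Function.update_of_ne h.1, ih h.2]

theorem ladderVal_congr {b : ι} {l : List (ι × ι)} {s s' : ι → Fin 2} (hb : s b = s' b)
    (h : ∀ c ∈ l.map Prod.fst, s c = s' c) : ladderVal b l s = ladderVal b l s' := by
  induction l with
  | nil => exact hb
  | cons p l ih =>
    simp only [List.map_cons, List.mem_cons, forall_eq_or_imp] at h
    rw [ladderVal, ladderVal, h.1, ih h.2]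

theorem ladderVal_eq (b : ι) (l : List (ι × ι)) (s : ι → Fin 2) :
    ladderVal b l s = if s b = 1 ∧ ∀ c ∈ l.map Prod.fst, s c = 0 then 1 else 0 := by
  induction l with
  | nil => rcases fin_two_cases (s b) with h | h <;> simp [ladderVal, h]
  | cons p l ih =>
    have h11 : (1 : Fin 2) + 1 = 0 := rfl
    rcases fin_two_cases (s p.1) with h | h <;> simp [ladderVal, h, ih, h11, -List.mem_map]

theorem ladderMap_update {b r : ι} {l : List (ι × ι)} (hb : r ≠ b) (h1 : r ∉ l.map Prod.fst)
    (h2 : r ∉ l.map Prod.snd) (s : ι → Fin 2) (v : Fin 2) :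
    ladderMap b l (Function.update s r v) = Function.update (ladderMap b l s) r v := by
  induction l with
  | nil => rfl
  | cons p l ih =>
    have hv : ladderVal b (p :: l) (Function.update s r v) = ladderVal b (p :: l) s :=
      ladderVal_congr (Function.update_of_ne hb.symm _ _) fun c hc =>
        Function.update_of_ne (fun h : c = r => h1 (h ▸ hc)) _ _
    simp only [List.map_cons, List.mem_cons, not_or] at h1 h2
    rw [ladderMap, ladderMap, ih h1.2 h2.2, hv, Function.update_of_ne (Ne.symm h2.1),
      Function.update_comm h2.1]

theorem IsLadder.head_snd {b : ι} {p : ι × ι} {l : List (ι × ι)} (h : IsLadder b (p :: l)) :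
    p.2 ≠ b ∧ p.2 ∉ l.map Prod.fst ∧ p.2 ∉ l.map Prod.snd :=
  ⟨fun h' => h.base_snd (h' ▸ List.mem_cons_self),
    fun h' => h.disjoint _ (List.mem_cons_of_mem _ h') List.mem_cons_self,
    (List.nodup_cons.1 h.nodup).1⟩

theorem IsLadder.ladderVal_ladderMap {b : ι} {l l' : List (ι × ι)} (h : IsLadder b l)
    (hl : l' <:+ l) (s : ι → Fin 2) : ladderVal b l (ladderMap b l' s) = ladderVal b l s := by
  have hs : ∀ r, r ∉ l.map Prod.snd → r ∉ l'.map Prod.snd := fun r hr h' =>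
    hr ((hl.map Prod.snd).subset h')
  exact ladderVal_congr (ladderMap_of_notMem (hs _ h.base_snd) s) fun c hc =>
    ladderMap_of_notMem (hs _ (h.disjoint c hc)) s

theorem IsLadder.ladderMap_ladderMap {b : ι} {l : List (ι × ι)} (h : IsLadder b l)
    (s : ι → Fin 2) : ladderMap b l (ladderMap b l s) = s := by
  induction l with
  | nil => rfl
  | cons p l ih =>
    have h2 : ∀ x y : Fin 2, x + y + y = x := by decide
    obtain ⟨h1, h3, h4⟩ := h.head_snd
    rw [ladderMap, h.ladderVal_ladderMap List.suffix_rfl, ladderMap, Function.update_self,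
      ladderMap_update h1 h3 h4, ih h.tail, Function.update_idem, h2, Function.update_eq_self]

/-- A ladder is realised by conjugating the shorter ladder with the Toffoli gate of the top rung:
the two Toffoli gates add the value of the next target before and after it is toggled. -/
theorem IsLadder.exists_circuit {b : ι} {l : List (ι × ι)} (h : IsLadder b l) :
    ∃ C : Circuit ι, C.length ≤ 38 * l.length ∧ Circuit.IsPerm C (ladderMap b l) := by
  induction l with
  | nil => exact ⟨[], by simp, fun ψ s => rfl⟩
  | cons p l ih =>
    obtain ⟨C, hC, hP⟩ := ih h.tail
    have hp : p.1 ≠ p.2 := fun h' => h.disjoint p.1 (by simp) (by simp [h'])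
    have hpb : p.1 ≠ b := fun h' => h.base_fst (by simp [← h'])
    obtain ⟨h1, h3, h4⟩ := h.head_snd
    cases l with
    | nil =>
      obtain ⟨T, hT, hTP⟩ := exists_toffoli hpb hp h1.symm
      exact ⟨T, by simp [hT], hTP⟩
    | cons p' l =>
      have hpp : p.1 ≠ p'.2 := fun h' => h.disjoint p.1 (by simp) (by simp [h'])
      have hpp2 : p'.2 ≠ p.2 := fun h' => h4 (by simp [h'])
      obtain ⟨T, hT, hTP⟩ := exists_toffoli hpp hp hpp2
      refine ⟨T ++ (C ++ T), by simp [hT] at hC ⊢; omega, fun ψ s => ?_⟩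
      rw [(hTP.append (hP.append hTP)) ψ s]
      have hp1 : p.1 ∉ (p' :: l).map Prod.snd := fun h' =>
        h.disjoint p.1 (by simp) (List.mem_cons_of_mem _ h')
      have key : ∀ x y z w : Fin 2, x + (1 + y) * z + (1 + y) * (z + w) = x + (1 + y) * w := by
        decide
      congr 1
      beta_reduce
      rw [ladderMap_update h1 h3 h4, Function.update_self, Function.update_of_ne hp,
        Function.update_of_ne hpp2, Function.update_idem, ladderMap_of_notMem hp1,
        show ladderMap b (p' :: l) s p'.2 = s p'.2 + ladderVal b (p' :: l) s by
          rw [ladderMap, Function.update_self], key]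
      rfl

/-- Running a ladder and then its part below the top rung toggles only the top target; the lower
targets serve as borrowed bits in arbitrary states. -/
theorem IsLadder.exists_toggle {b : ι} {p : ι × ι} {l : List (ι × ι)} (h : IsLadder b (p :: l)) :
    ∃ C : Circuit ι, C.length ≤ 76 * (l.length + 1) ∧ Circuit.IsPerm C
      (fun s => Function.update s p.2 (s p.2 + ladderVal b (p :: l) s)) := by
  obtain ⟨C, hC, hP⟩ := h.exists_circuit
  obtain ⟨C', hC', hP'⟩ := h.tail.exists_circuit
  refine ⟨C ++ C', by simp at hC hC' ⊢; omega, fun ψ s => ?_⟩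
  rw [(hP.append hP') ψ s]
  beta_reduce
  rw [ladderMap, h.ladderVal_ladderMap (List.suffix_cons _ _),
    h.tail.ladderMap_ladderMap, ladderMap_of_notMem h.head_snd.2.2]

theorem map_snd_zip_sublist {α β : Type} (l : List α) (l' : List β) :
    List.Sublist ((l.zip l').map Prod.snd) l' := by
  induction l generalizing l' with
  | nil => simp
  | cons a l ih =>
    cases l' with
    | nil => simp
    | cons b l' => simpa using ih l'

/-- Toggling `t` by `a` and `u` by `t * b` alternately, twice each, toggles `u` by `a * b`. -/
theorem toggle_commutator {t u : ι} (htu : t ≠ u) {a b : (ι → Fin 2) → Fin 2}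
    (hat : ∀ s v, a (Function.update s t v) = a s) (hau : ∀ s v, a (Function.update s u v) = a s)
    (hbt : ∀ s v, b (Function.update s t v) = b s) (hbu : ∀ s v, b (Function.update s u v) = b s)
    (s : ι → Fin 2) :
    let f : (ι → Fin 2) → (ι → Fin 2) := fun s => Function.update s t (s t + a s)
    let g : (ι → Fin 2) → (ι → Fin 2) := fun s => Function.update s u (s u + s t * b s)
    f (g (f (g s))) = Function.update s u (s u + a s * b s) := by
  have key : ∀ x y z w : Fin 2, w + x * y + (x + z) * y = w + z * y := by decide
  have key' : ∀ x y : Fin 2, x + y + y = x := by decide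
  intro f g
  funext r
  by_cases ht : r = t
  · subst ht
    simp [f, g, hat, hau, Function.update_of_ne htu, key']
  · by_cases hu : r = u
    · subst hu
      simp [f, g, hau, hbt, hbu, Function.update_of_ne htu, Function.update_of_ne htu.symm, key]
    · simp [f, g, ht, hu]

/-- Toggling `u` by a predicate between two applications of the gate `Z` yields a sign on the
predicate, whatever the state of `u`. -/
theorem phase_kickback {u : ι} {p : (ι → Fin 2) → Prop} [DecidablePred p] {C : Circuit ι}
    (hp : ∀ s v, p (Function.update s u v) ↔ p s)
    (hC : Circuit.IsPerm C (fun s => Function.update s u (s u + if p s then 1 else 0))) :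
    Circuit.IsDiag (C ++ ([phase u 1 (-1)] ++ (C ++ [phase u 1 (-1)])))
      (fun s => if p s then -1 else 1) := by
  intro ψ s
  have hz := isDiag_phase u 1 (-1)
  have h11 : (1 : Fin 2) + 1 = 0 := rfl
  rw [Circuit.run_append, Circuit.run_append, Circuit.run_append, hz, hC, hz, hC]
  have hs : ψ (Function.update s u (s u)) = ψ s := by rw [Function.update_eq_self]
  by_cases h : p s <;> rcases fin_two_cases (s u) with hu | hu <;> rw [hu] at hs <;>
    simp [h, hp, hu, hs, h11]

/-- The reflection that flips the sign of the basis states with `q = 1`, `w = 0` and all qubits of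
`A` and `B` equal to `0`, in linearly many gates. One ladder accumulates the condition on `A` in
the borrowed bit `t`, with targets taken from `B`; the other one combines it with the condition on
`B` in the bit `u`, with targets taken from `A`. No qubit need be clean. -/
theorem exists_reflection {q t u w : ι} {A B : List ι}
    (hnd : (q :: t :: u :: w :: (A ++ B)).Nodup) (hAB : A.length ≤ B.length)
    (hBA : B.length ≤ A.length + 1) :
    ∃ C : Circuit ι, C.length ≤ 304 * (A.length + B.length + 2) + 2 ∧ Circuit.IsDiag C
      (fun s => if s q = 1 ∧ s w = 0 ∧ ∀ r ∈ A ++ B, s r = 0 then -1 else 1) := by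
  simp only [List.nodup_cons, List.mem_cons, List.mem_append, not_or, List.nodup_append] at hnd
  obtain ⟨⟨hqt, hqu, hqw, hqA, hqB⟩, ⟨htu, htw, htA, htB⟩, ⟨huw, huA, huB⟩, ⟨hwA, hwB⟩,
    hA, hB, hdis⟩ := hnd
  have f1 : ((w :: A).zip (t :: B)).map Prod.fst = w :: A :=
    List.map_fst_zip (by simpa using hAB)
  have f2 : ((w :: B).zip (u :: q :: A)).map Prod.fst = w :: B :=
    List.map_fst_zip (by simpa using hBA)
  have g1 := map_snd_zip_sublist (w :: A) (t :: B)
  have g2 := map_snd_zip_sublist (w :: B) (u :: q :: A)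
  have l1 : IsLadder q ((w, t) :: A.zip B) := by
    refine ⟨?_, fun h => ?_, g1.nodup ?_, fun c hc h => ?_⟩
    · rw [← List.zip_cons_cons, f1]; simp [hqw, hqA]
    · have := g1.subset h; simp [hqt, hqB] at this
    · simp [htB, hB]
    · rw [← List.zip_cons_cons, f1] at hc
      have := g1.subset h
      simp only [List.mem_cons] at hc this
      rcases hc with rfl | hc
      · rcases this with h | h
        exacts [htw h.symm, hwB h]
      · rcases this with rfl | h
        exacts [htA hc, hdis c hc c h rfl]
  have l2 : IsLadder t ((w, u) :: B.zip (q :: A)) := by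
    refine ⟨?_, fun h => ?_, g2.nodup ?_, fun c hc h => ?_⟩
    · rw [← List.zip_cons_cons, f2]; simp [htw, htB]
    · have := g2.subset h; simp [Ne.symm hqt, htu, htA] at this
    · simp [Ne.symm hqu, huA, hqA, hA]
    · rw [← List.zip_cons_cons, f2] at hc
      have := g2.subset h
      simp only [List.mem_cons] at hc this
      rcases hc with rfl | hc
      · rcases this with h | h | h
        exacts [huw h.symm, hqw h.symm, hwA h]
      · rcases this with rfl | rfl | h
        exacts [huB hc, hqB hc, hdis c h c hc rfl]
  obtain ⟨C1, hC1, hP1⟩ := l1.exists_toggle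
  obtain ⟨C2, hC2, hP2⟩ := l2.exists_toggle
  have upd : ∀ (C : List ι) (x : ι), x ∉ C → ∀ (s : ι → Fin 2) v,
      (∀ r ∈ C, Function.update s x v r = 0) ↔ ∀ r ∈ C, s r = 0 := fun C x hx s v =>
    forall₂_congr fun r hr => by
      rw [Function.update_of_ne (fun h : r = x => hx (h ▸ hr))]
  have toggle : Circuit.IsPerm (C1 ++ (C2 ++ (C1 ++ C2))) (fun s => Function.update s u
      (s u + if s q = 1 ∧ s w = 0 ∧ ∀ r ∈ A ++ B, s r = 0 then 1 else 0)) := by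
    have v1 : ∀ s, ladderVal q ((w, t) :: A.zip B) s =
        if s q = 1 ∧ s w = 0 ∧ ∀ r ∈ A, s r = 0 then 1 else 0 := fun s => by
      rw [ladderVal_eq, ← List.zip_cons_cons, f1]; simp
    have v2 : ∀ s, ladderVal t ((w, u) :: B.zip (q :: A)) s =
        s t * if s w = 0 ∧ ∀ r ∈ B, s r = 0 then 1 else 0 := fun s => by
      rw [ladderVal_eq, ← List.zip_cons_cons, f2]
      rcases fin_two_cases (s t) with h | h <;> simp [h]
    set a : (ι → Fin 2) → Fin 2 := fun s =>
      if s q = 1 ∧ s w = 0 ∧ ∀ r ∈ A, s r = 0 then 1 else 0 with ha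
    set b : (ι → Fin 2) → Fin 2 := fun s =>
      if s w = 0 ∧ ∀ r ∈ B, s r = 0 then 1 else 0 with hb
    have hP1' : Circuit.IsPerm C1 (fun s => Function.update s t (s t + a s)) := fun ψ s => by
      simp only [hP1 ψ s, v1, ha]
    have hP2' : Circuit.IsPerm C2 (fun s => Function.update s u (s u + s t * b s)) := fun ψ s => by
      simp only [hP2 ψ s, v2, hb]
    intro ψ s
    rw [(hP1'.append (hP2'.append (hP1'.append hP2'))) ψ s, toggle_commutator htu]
    · congr 3
      simp only [ha, hb, List.mem_append, or_imp, forall_and, mul_ite, mul_one, mul_zero, ← ite_and]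
      exact if_congr (by tauto) rfl rfl
    · intro s v
      simp only [ha, upd A t htA, Function.update_of_ne hqt, Function.update_of_ne (Ne.symm htw)]
    · intro s v
      simp only [ha, upd A u huA, Function.update_of_ne hqu, Function.update_of_ne (Ne.symm huw)]
    · intro s v
      simp only [hb, upd B t htB, Function.update_of_ne (Ne.symm htw)]
    · intro s v
      simp only [hb, upd B u huB, Function.update_of_ne (Ne.symm huw)]
  refine ⟨(C1 ++ (C2 ++ (C1 ++ C2))) ++ ([phase u 1 (-1)] ++
      ((C1 ++ (C2 ++ (C1 ++ C2))) ++ [phase u 1 (-1)])), ?_, fun ψ s => ?_⟩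
  · simp at hC1 hC2 ⊢; omega
  · have hp : ∀ (s : ι → Fin 2) v, (Function.update s u v q = 1 ∧ Function.update s u v w = 0 ∧
        ∀ r ∈ A ++ B, Function.update s u v r = 0) ↔ s q = 1 ∧ s w = 0 ∧ ∀ r ∈ A ++ B, s r = 0 :=
      fun s v => by
        rw [Function.update_of_ne hqu, Function.update_of_ne (Ne.symm huw)]
        simp only [List.mem_append, or_imp, forall_and, upd A u huA, upd B u huB]
    exact phase_kickback hp toggle ψ s

end Reflection

/-! ### Complementary polynomials on the unit circle -/

section FejerRiesz

open Polynomial ComplexConjugate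

/-- The polynomial `z ^ N * conj (Q (1 / conj z))`. -/
def conjReflect (N : ℕ) (Q : ℂ[X]) : ℂ[X] := (Q.map (starRingEnd ℂ)).reflect N

theorem coeff_conjReflect_zero (N : ℕ) (Q : ℂ[X]) :
    (conjReflect N Q).coeff 0 = conj (Q.coeff N) := by
  simp [conjReflect, coeff_reflect]

theorem natDegree_conjReflect_le {N : ℕ} {Q : ℂ[X]} (h : Q.natDegree ≤ N) :
    (conjReflect N Q).natDegree ≤ N := by
  refine (natDegree_reflect_le).trans ?_
  simpa using h

theorem eval_conjReflect {N : ℕ} {Q : ℂ[X]} (h : Q.natDegree ≤ N) {z : ℂ} (hz : z ≠ 0) :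
    (conjReflect N Q).eval z = z ^ N * conj (Q.eval (conj z)⁻¹) := by
  have hz' : Invertible z⁻¹ := invertibleOfNonzero (inv_ne_zero hz)
  have := eval₂_reflect_mul_pow (RingHom.id ℂ) z⁻¹ N (Q.map (starRingEnd ℂ)) (by simpa using h)
  rw [invOf_eq_inv, inv_inv, eval₂_id, eval₂_id] at this
  have h2 : (Q.map (starRingEnd ℂ)).eval z⁻¹ = conj (Q.eval (conj z)⁻¹) := by
    rw [eval_map, ← eval₂_hom, map_inv₀, Complex.conj_conj]
  rw [← h2, ← this, conjReflect, mul_comm, mul_assoc, ← mul_pow, inv_mul_cancel₀ hz, one_pow,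
    mul_one]

theorem inv_conj_of_norm_eq_one {z : ℂ} (hz : ‖z‖ = 1) : (conj z)⁻¹ = z := by
  rw [← Complex.inv_eq_conj hz, inv_inv]

theorem eval_conjReflect_of_norm_eq_one {N : ℕ} {Q : ℂ[X]} (h : Q.natDegree ≤ N) {z : ℂ}
    (hz : ‖z‖ = 1) : (conjReflect N Q).eval z = z ^ N * conj (Q.eval z) := by
  rw [eval_conjReflect h (fun h0 => by simp [h0] at hz), inv_conj_of_norm_eq_one hz]

theorem eq_of_eval_circle {P Q : ℂ[X]} (h : ∀ z : ℂ, ‖z‖ = 1 → P.eval z = Q.eval z) : P = Q := by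
  refine Polynomial.eq_of_infinite_eval_eq P Q (Set.Infinite.mono (s := Set.range fun x : Circle =>
    (x : ℂ)) ?_ ?_)
  · rintro _ ⟨x, rfl⟩
    exact h _ (Circle.norm_coe x)
  · have : Infinite Circle := Circle.argEquiv.infinite_iff.2
      (Set.Ioc_infinite (by linarith [Real.pi_pos])).to_subtype
    exact Set.infinite_range_of_injective Circle.coe_injective

/-- The Fejér–Riesz theorem for strictly positive trigonometric polynomials: if
`z⁻ᴰ * G z > 0` on the unit circle then this function is `|R z| ^ 2` for a polynomial `R` of degree
at most `D`. The nonzero roots of `G` come in pairs `l`, `1 / conj l`, and each pair contributes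
`-z * |z - l| ^ 2 / conj l`. A root at the origin is matched by a vanishing top coefficient. -/
theorem exists_normSq_eq (D : ℕ) (G : ℂ[X]) (hG : G.natDegree ≤ 2 * D)
    (hpos : ∀ z : ℂ, ‖z‖ = 1 → ∃ r : ℝ, 0 < r ∧ G.eval z = r * z ^ D) :
    ∃ R : ℂ[X], R.natDegree ≤ D ∧
      ∀ z : ℂ, ‖z‖ = 1 → G.eval z = ((‖R.eval z‖ ^ 2 : ℝ) : ℂ) * z ^ D := by
  induction D generalizing G with
  | zero =>
    obtain ⟨a, ha⟩ := natDegree_eq_zero.1 (Nat.le_zero.1 hG)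
    obtain ⟨r, hr, h⟩ := hpos 1 (by simp)
    refine ⟨C ((√r : ℝ) : ℂ), by simp, fun z _ => ?_⟩
    subst ha
    simp only [eval_C, pow_zero, mul_one] at h ⊢
    rw [h, Complex.norm_real, Real.norm_eq_abs, sq_abs, Real.sq_sqrt hr.le]
  | succ D ih =>
    -- a function real on the circle has a self-reciprocal numerator
    have hself : conjReflect (2 * (D + 1)) G = G := by
      refine eq_of_eval_circle fun z hz => ?_
      rw [eval_conjReflect_of_norm_eq_one hG hz]
      obtain ⟨r, -, h⟩ := hpos z hz
      have hzz : z * conj z = 1 := by rw [Complex.mul_conj, Complex.normSq_eq_norm_sq, hz]; simp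
      rw [h, map_mul, map_pow, Complex.conj_ofReal, two_mul, pow_add]
      calc z ^ (D + 1) * z ^ (D + 1) * (r * conj z ^ (D + 1))
          = r * z ^ (D + 1) * (z * conj z) ^ (D + 1) := by rw [mul_pow]; ring
        _ = _ := by rw [hzz, one_pow, mul_one]
    have hne : ∀ z : ℂ, ‖z‖ = 1 → z ≠ 0 := fun z hz h0 => by simp [h0] at hz
    have hc0 : G.coeff 0 = conj (G.coeff (2 * (D + 1))) := by
      conv_lhs => rw [← hself, coeff_conjReflect_zero]
    by_cases h0 : G.coeff 0 = 0
    · have htop : G.coeff (2 * (D + 1)) = 0 := by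
        rw [h0] at hc0
        simpa using hc0.symm
      have hX : G = X * G.divX := by
        conv_lhs => rw [← divX_mul_X_add G, h0, C_0, add_zero, mul_comm]
      obtain ⟨R, hR, h⟩ := ih G.divX (by
        rw [natDegree_divX_eq_natDegree_tsub_one]
        have : G.natDegree ≠ 2 * (D + 1) := fun h => by
          have hG0 : G = 0 := by rwa [← h, coeff_natDegree, leadingCoeff_eq_zero] at htop
          rw [hG0, natDegree_zero] at h
          omega
        omega) (fun z hz => by
          obtain ⟨r, hr, h⟩ := hpos z hz
          refine ⟨r, hr, mul_left_cancel₀ (hne z hz) ?_⟩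
          rw [hX, eval_mul, eval_X] at h
          rw [h]; ring)
      refine ⟨R, hR.trans (Nat.le_succ D), fun z hz => ?_⟩
      rw [hX, eval_mul, eval_X, h z hz]
      ring
    · have hdeg : G.degree ≠ 0 := fun h => by
        have : G.coeff (2 * (D + 1)) = 0 := coeff_eq_zero_of_degree_lt (by
          rw [h]; exact_mod_cast (by omega : 0 < 2 * (D + 1)))
        simp [hc0, this] at h0
      obtain ⟨l, hl⟩ := IsAlgClosed.exists_root G hdeg
      rw [IsRoot.def] at hl
      have hl0 : l ≠ 0 := fun h => h0 (by rw [h] at hl; rwa [coeff_zero_eq_eval_zero])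
      have hl1 : ‖l‖ ≠ 1 := fun h => by
        obtain ⟨r, hr, h'⟩ := hpos l h
        rw [hl] at h'
        simp [hr.ne', hl0] at h'
      have hlc : conj l ≠ 0 := (_root_.map_ne_zero _).2 hl0
      have hm : G.eval (conj l)⁻¹ = 0 := by
        rw [← hself, eval_conjReflect hG (inv_ne_zero hlc)]
        simp [hl]
      have hlm : (conj l)⁻¹ ≠ l := fun h => hl1 (by
        have : l * conj l = 1 := by nth_rw 1 [← h]; exact inv_mul_cancel₀ hlc
        rw [Complex.mul_conj, Complex.normSq_eq_norm_sq] at this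
        have h1 : ‖l‖ ^ 2 = 1 := by exact_mod_cast this
        exact (pow_eq_one_iff_of_nonneg (norm_nonneg _) two_ne_zero).1 h1 )
      obtain ⟨G₁, hG₁⟩ := dvd_iff_isRoot.2 hl
      obtain ⟨G₂, hG₂⟩ := dvd_iff_isRoot.2 (show G₁.IsRoot (conj l)⁻¹ by
        rw [hG₁, eval_mul] at hm
        simpa [sub_eq_zero, hlm] using hm)
      have hG2 : G = (X - C l) * ((X - C (conj l)⁻¹) * G₂) := by rw [hG₁, hG₂]
      have hG20 : G₂ ≠ 0 := fun h => h0 (by rw [hG2, h]; simp)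
      have hcirc : ∀ z : ℂ, ‖z‖ = 1 → G.eval z =
          ((‖z - l‖ ^ 2 : ℝ) : ℂ) * z * (C (-(conj l)⁻¹) * G₂).eval z := fun z hz => by
        have hzz : z * conj z = 1 := by rw [Complex.mul_conj, Complex.normSq_eq_norm_sq, hz]; simp
        rw [hG2, ← Complex.normSq_eq_norm_sq, ← Complex.mul_conj, map_sub]
        simp only [eval_mul, eval_sub, eval_X, eval_C]
        have : (z - (conj l)⁻¹) = (conj z - conj l) * z * (-(conj l)⁻¹) := by
          field_simp
          linear_combination hzz
        rw [this]; ring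
      have hpos' : ∀ z : ℂ, ‖z‖ = 1 → 0 < ‖z - l‖ ^ 2 := fun z hz => by
        have : z - l ≠ 0 := fun h => hl1 (by rw [← sub_eq_zero.1 h, hz])
        positivity
      obtain ⟨R, hR, h⟩ := ih (C (-(conj l)⁻¹) * G₂) (by
          have hd : G.natDegree = G₂.natDegree + 2 := by
            rw [hG2, natDegree_mul (X_sub_C_ne_zero _) (mul_ne_zero (X_sub_C_ne_zero _) hG20),
              natDegree_mul (X_sub_C_ne_zero _) hG20, natDegree_X_sub_C, natDegree_X_sub_C]
            ring
          have := natDegree_C_mul_le (-(conj l)⁻¹) G₂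
          omega) (fun z hz => by
          obtain ⟨r, hr, h⟩ := hpos z hz
          have hp := hpos' z hz
          refine ⟨r / ‖z - l‖ ^ 2, by positivity, ?_⟩
          rw [hcirc z hz] at h
          have hp' : ((‖z - l‖ ^ 2 : ℝ) : ℂ) ≠ 0 := by exact_mod_cast hp.ne'
          refine mul_left_cancel₀ (mul_ne_zero hp' (hne z hz)) (h.trans ?_)
          rw [Complex.ofReal_div]
          field_simp
          ring)
      refine ⟨(X - C l) * R, ?_, fun z hz => ?_⟩
      · refine natDegree_mul_le.trans ?_
        rw [natDegree_X_sub_C]; omega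
      · rw [hcirc z hz, h z hz, eval_mul, norm_mul, eval_sub, eval_X, eval_C]
        push_cast
        ring

/-- A polynomial that is smaller than `1` on the unit circle has a complementary polynomial of the
same degree bound. -/
theorem exists_complement (D : ℕ) (Q : ℂ[X]) (hQ : Q.natDegree ≤ D)
    (hlt : ∀ z : ℂ, ‖z‖ = 1 → ‖Q.eval z‖ < 1) :
    ∃ R : ℂ[X], R.natDegree ≤ D ∧
      ∀ z : ℂ, ‖z‖ = 1 → ‖Q.eval z‖ ^ 2 + ‖R.eval z‖ ^ 2 = 1 := by
  have hev : ∀ z : ℂ, ‖z‖ = 1 → (X ^ D - Q * conjReflect D Q).eval z =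
      ((1 - ‖Q.eval z‖ ^ 2 : ℝ) : ℂ) * z ^ D := fun z hz => by
    rw [eval_sub, eval_pow, eval_X, eval_mul, eval_conjReflect_of_norm_eq_one hQ hz,
      ← Complex.normSq_eq_norm_sq, Complex.ofReal_sub, ← Complex.mul_conj]
    push_cast
    ring
  obtain ⟨R, hR, h⟩ := exists_normSq_eq D (X ^ D - Q * conjReflect D Q) (by
      refine (natDegree_sub_le _ _).trans (max_le (by rw [natDegree_X_pow]; omega) ?_)
      refine natDegree_mul_le.trans ?_
      have := natDegree_conjReflect_le hQ
      omega) (fun z hz => ⟨1 - ‖Q.eval z‖ ^ 2, by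
        have := hlt z hz
        nlinarith [norm_nonneg (Q.eval z)], hev z hz⟩)
  refine ⟨R, hR, fun z hz => ?_⟩
  have hz0 : z ≠ 0 := fun h => by simp [h] at hz
  have := mul_right_cancel₀ (pow_ne_zero D hz0) ((hev z hz).symm.trans (h z hz))
  have h2 := Complex.ofReal_injective this
  linarith

/-- The ends of a pair of complementary polynomials are orthogonal coefficient vectors. -/
theorem coeff_orthogonal {D : ℕ} {Q R : ℂ[X]} (hQ : Q.natDegree ≤ D + 1) (hR : R.natDegree ≤ D + 1)
    (h : ∀ z : ℂ, ‖z‖ = 1 → ‖Q.eval z‖ ^ 2 + ‖R.eval z‖ ^ 2 = 1) :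
    Q.coeff 0 * conj (Q.coeff (D + 1)) + R.coeff 0 * conj (R.coeff (D + 1)) = 0 := by
  have key : Q * conjReflect (D + 1) Q + R * conjReflect (D + 1) R = X ^ (D + 1) := by
    refine eq_of_eval_circle fun z hz => ?_
    rw [eval_add, eval_mul, eval_mul, eval_conjReflect_of_norm_eq_one hQ hz,
      eval_conjReflect_of_norm_eq_one hR hz, eval_pow, eval_X]
    have := h z hz
    rw [← Complex.normSq_eq_norm_sq, ← Complex.normSq_eq_norm_sq] at this
    have h2 : (Q.eval z * conj (Q.eval z) + R.eval z * conj (R.eval z)) = 1 := by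
      rw [Complex.mul_conj, Complex.mul_conj, ← Complex.ofReal_add, this, Complex.ofReal_one]
    linear_combination z ^ (D + 1) * h2
  have := congrArg (fun p => Polynomial.coeff p 0) key
  simpa [mul_coeff_zero, coeff_conjReflect_zero] using this

end FejerRiesz

/-! ### Generalised quantum signal processing -/

section SignalProcessing

open Polynomial ComplexConjugate

/-- The special unitary matrix with first column `(e, f)`. -/
def specialUnitary (e f : ℂ) (h : ‖e‖ ^ 2 + ‖f‖ ^ 2 = 1) : Matrix.unitaryGroup (Fin 2) ℂ :=
  ⟨!![e, -conj f; f, conj e], by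
    have h' : conj e * e + conj f * f = 1 := by
      rw [← Complex.normSq_eq_conj_mul_self, ← Complex.normSq_eq_conj_mul_self,
        Complex.normSq_eq_norm_sq, Complex.normSq_eq_norm_sq, ← Complex.ofReal_add, h,
        Complex.ofReal_one]
    rw [Matrix.mem_unitaryGroup_iff', Matrix.star_eq_conjTranspose]
    ext i j
    fin_cases i <;> fin_cases j <;> simp [Matrix.mul_apply]
    · exact h'
    · ring
    · ring
    · linear_combination h'⟩

theorem exists_normalize {a b : ℂ} (h : ¬ (a = 0 ∧ b = 0)) :
    ∃ r : ℝ, r ≠ 0 ∧ ‖a / r‖ ^ 2 + ‖b / r‖ ^ 2 = 1 := by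
  have hpos : 0 < ‖a‖ ^ 2 + ‖b‖ ^ 2 := by
    by_cases ha : a = 0
    · have hb : b ≠ 0 := fun hb => h ⟨ha, hb⟩
      positivity
    · positivity
  refine ⟨√(‖a‖ ^ 2 + ‖b‖ ^ 2), (Real.sqrt_pos.2 hpos).ne', ?_⟩
  rw [norm_div, norm_div, Complex.norm_real, div_pow, div_pow, Real.norm_eq_abs, sq_abs,
    Real.sq_sqrt hpos.le, ← add_div, div_self hpos.ne']

/-- Given orthogonal vectors `(a, b)` and `(c, d)`, some unit vector is orthogonal to the first and
parallel to the second. -/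
theorem exists_unit_orthogonal {a b c d : ℂ} (h : a * conj c + b * conj d = 0) :
    ∃ e f : ℂ, ‖e‖ ^ 2 + ‖f‖ ^ 2 = 1 ∧ conj e * a + conj f * b = 0 ∧ e * d - f * c = 0 := by
  by_cases hcd : c = 0 ∧ d = 0
  · by_cases hab : a = 0 ∧ b = 0
    · exact ⟨1, 0, by simp, by simp [hab], by simp [hcd]⟩
    · obtain ⟨r, hr, hn⟩ := exists_normalize hab
      refine ⟨conj (b / r), -conj (a / r), ?_, ?_, by simp [hcd]⟩
      · rw [norm_neg, RCLike.norm_conj, RCLike.norm_conj, add_comm, hn]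
      · rw [map_neg, Complex.conj_conj, Complex.conj_conj]
        ring
  · obtain ⟨r, hr, hn⟩ := exists_normalize hcd
    refine ⟨c / r, d / r, hn, ?_, by ring⟩
    rw [map_div₀, map_div₀, Complex.conj_ofReal]
    linear_combination h / (r : ℂ)

/-- Pairs of complementary polynomials of degree at most `D + 1` arise from pairs of degree at most
`D` by a multiplication of the first one by `z` and a constant unitary. -/
theorem exists_layer {D : ℕ} {Q R : ℂ[X]} (hQ : Q.natDegree ≤ D + 1) (hR : R.natDegree ≤ D + 1)
    (h : ∀ z : ℂ, ‖z‖ = 1 → ‖Q.eval z‖ ^ 2 + ‖R.eval z‖ ^ 2 = 1) :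
    ∃ (U : Matrix.unitaryGroup (Fin 2) ℂ) (Q' R' : ℂ[X]), Q'.natDegree ≤ D ∧ R'.natDegree ≤ D ∧
      (∀ z : ℂ, ‖z‖ = 1 → ‖Q'.eval z‖ ^ 2 + ‖R'.eval z‖ ^ 2 = 1) ∧
      ∀ z : ℂ, Q.eval z = U.1 0 0 * (z * Q'.eval z) + U.1 0 1 * R'.eval z ∧
        R.eval z = U.1 1 0 * (z * Q'.eval z) + U.1 1 1 * R'.eval z := by
  obtain ⟨e, f, hn, h1, h2⟩ := exists_unit_orthogonal (coeff_orthogonal hQ hR h)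
  have hn' : e * conj e + f * conj f = 1 := by
    rw [Complex.mul_conj, Complex.mul_conj, Complex.normSq_eq_norm_sq, Complex.normSq_eq_norm_sq,
      ← Complex.ofReal_add, hn, Complex.ofReal_one]
  set S : ℂ[X] := C (conj e) * Q + C (conj f) * R with hS
  have hS0 : S = X * S.divX := by
    have : S.coeff 0 = 0 := by simpa [hS] using h1
    conv_lhs => rw [← divX_mul_X_add S, this, C_0, add_zero, mul_comm]
  have hSd : S.natDegree ≤ D + 1 := (natDegree_add_le _ _).trans
    (max_le ((natDegree_C_mul_le _ _).trans hQ) ((natDegree_C_mul_le _ _).trans hR))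
  have hSe : ∀ z, z * S.divX.eval z = conj e * Q.eval z + conj f * R.eval z := fun z => by
    have := congrArg (Polynomial.eval z) hS0
    rw [eval_mul, eval_X] at this
    rw [← this, hS]
    simp
  have hTe : ∀ z, (C e * R - C f * Q).eval z = e * R.eval z - f * Q.eval z := fun z => by simp
  have hrec : ∀ z, Q.eval z = e * (z * S.divX.eval z) + -conj f * (C e * R - C f * Q).eval z ∧
      R.eval z = f * (z * S.divX.eval z) + conj e * (C e * R - C f * Q).eval z := fun z => by
    rw [hSe, hTe]
    constructor
    · linear_combination -(Q.eval z) * hn'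
    · linear_combination -(R.eval z) * hn'
  refine ⟨specialUnitary e f hn, S.divX, C e * R - C f * Q, ?_, ?_, fun z hz => ?_, hrec⟩
  · rw [natDegree_divX_eq_natDegree_tsub_one]
    omega
  · refine natDegree_le_iff_coeff_eq_zero.2 fun N hN => ?_
    rcases eq_or_lt_of_le (Nat.succ_le_of_lt hN) with rfl | hN'
    · simpa using h2
    · simp [coeff_eq_zero_of_natDegree_lt (hQ.trans_lt hN'),
        coeff_eq_zero_of_natDegree_lt (hR.trans_lt hN')]
  · have hzn : ‖S.divX.eval z‖ ^ 2 = ‖z * S.divX.eval z‖ ^ 2 := by rw [norm_mul, hz, one_mul]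
    rw [← h z hz, hzn]
    obtain ⟨hq, hr⟩ := hrec z
    apply Complex.ofReal_injective
    generalize z * S.divX.eval z = x at hq hr
    generalize (C e * R - C f * Q).eval z = y at hq hr
    simp only [← Complex.normSq_eq_norm_sq, Complex.ofReal_add, ← Complex.mul_conj, hq, hr,
      map_add, map_mul, map_neg, Complex.conj_conj]
    linear_combination (-(x * conj x + y * conj y)) * hn'

variable {n : ℕ}

/-- The state of `n` data qubits and the first ancilla given by `v`, with the other three ancillas
in the state `|0⟩`. -/
def ancState (v : (Fin n → Fin 2) → Fin 2 → ℂ) : StateVec (Fin n ⊕ Fin 4) := fun s =>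
  if s (.inr 1) = 0 ∧ s (.inr 2) = 0 ∧ s (.inr 3) = 0 then v (s ∘ .inl) (s (.inr 0)) else 0

/-- The phase `exp (ix / N)` for the number `x` with binary digits `y`. -/
def gridPhase (y : Fin n → Fin 2) : Circle :=
  Circle.exp (((finFunctionFinEquiv y : Fin (2 ^ n)) : ℕ) / 2 ^ n)

theorem single_ancState (U : Matrix.unitaryGroup (Fin 2) ℂ)
    (v : (Fin n → Fin 2) → Fin 2 → ℂ) :
    Circuit.run [.single (.inr 0) U] (ancState v) =
      ancState fun y i => U.1 i 0 * v y 0 + U.1 i 1 * v y 1 := by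
  funext s
  have hc : ∀ j : Fin 2, (Function.update s (.inr 0) j) ∘ Sum.inl = s ∘ Sum.inl := fun j => by
    funext k; simp
  rw [Circuit.run_cons, Circuit.run_nil]
  simp only [Gate.apply, ancState, Fin.sum_univ_two, hc, Function.update_self]
  rw [Function.update_of_ne (by simp), Function.update_of_ne (by simp),
    Function.update_of_ne (by simp), Function.update_of_ne (by simp),
    Function.update_of_ne (by simp), Function.update_of_ne (by simp)]
  split_ifs <;> simp

/-- The phase `exp (ikx / N)` is the product of the phases of the binary digits of `x`. -/
theorem gridPhase_pow (y : Fin n → Fin 2) (k : ℤ) :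
    ((List.finRange n).map fun j => if y j = 0 then (1 : ℂ) else
      (Circle.exp (k * (2 ^ (j : ℕ) / 2 ^ n)) : ℂ)).prod = (gridPhase y : ℂ) ^ k := by
  have h : ∀ j, (if y j = 0 then (1 : ℂ) else (Circle.exp (k * (2 ^ (j : ℕ) / 2 ^ n)) : ℂ)) =
      (Circle.exp (k * ((y j : ℕ) * 2 ^ (j : ℕ) / 2 ^ n)) : ℂ) := fun j => by
    rcases fin_two_cases (y j) with h | h <;> simp [h]
  simp only [h]
  rw [← List.ofFn_eq_map, List.prod_ofFn, gridPhase, ← Circle.coe_zpow, ← Circle.exp_zsmul,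
    finFunctionFinEquiv_apply]
  simp only [Circle.coe_exp]
  rw [← Complex.exp_sum, ← Finset.sum_mul]
  congr 2
  rw [← Complex.ofReal_sum]
  congr 1
  rw [← Finset.mul_sum, ← Finset.sum_div, zsmul_eq_mul]
  push_cast
  rfl

/-- The layer `diag (z, 1)` on the first ancilla, with `z = exp (ix / N)`. -/
def signalLayer (n : ℕ) : Circuit (Fin n ⊕ Fin 4) :=
  (List.finRange n).flatMap fun j =>
    cphase (.inr 0) (.inl j) Sum.inr_ne_inl (2 ^ (j : ℕ) / 2 ^ n)

theorem length_signalLayer (n : ℕ) : (signalLayer n).length = 5 * n := by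
  simp [signalLayer, List.length_flatMap, length_cphase, mul_comm]

theorem signalLayer_ancState (v : (Fin n → Fin 2) → Fin 2 → ℂ) :
    Circuit.run (signalLayer n) (ancState v) =
      ancState fun y i => (if i = 0 then (gridPhase y : ℂ) else 1) * v y i := by
  funext s
  rw [signalLayer, Circuit.IsDiag.flatMap _ fun j => isDiag_cphase _ _ _ _, ancState, ancState,
    mul_ite, mul_zero]
  congr 2
  by_cases hq : s (.inr 0) = 0
  · have := gridPhase_pow (s ∘ Sum.inl) 1
    simp only [Int.cast_one, one_mul, zpow_one] at this
    simp [hq, ← this]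
  · simp [hq]

/-- The circuit multiplying by `exp (-ix / N) ^ d`. -/
def phaseLayer (n d : ℕ) : Circuit (Fin n ⊕ Fin 4) :=
  (List.finRange n).flatMap fun j =>
    [phase (.inl j) 1 (Circle.exp (((-d : ℤ) : ℝ) * ((2 : ℝ) ^ (j : ℕ) / (2 : ℝ) ^ n)))]

theorem length_phaseLayer (n d : ℕ) : (phaseLayer n d).length = n := by
  simp [phaseLayer, List.length_flatMap]

theorem phaseLayer_ancState (d : ℕ) (v : (Fin n → Fin 2) → Fin 2 → ℂ) :
    Circuit.run (phaseLayer n d) (ancState v) =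
      ancState fun y i => ((gridPhase y : ℂ) ^ d)⁻¹ * v y i := by
  funext s
  rw [phaseLayer, Circuit.IsDiag.flatMap _ fun j => isDiag_phase _ _ _, ancState, ancState,
    mul_ite, mul_zero]
  congr 2
  have := gridPhase_pow (s ∘ Sum.inl) (-d)
  rw [zpow_neg, zpow_natCast] at this
  exact this

/-- Generalised quantum signal processing: complementary polynomials of degree at most `D` in
`z = exp (ix / N)` are the amplitudes of the first ancilla after `D` signal layers interleaved with
single-qubit gates, by repeatedly splitting off the outermost layer. -/
theorem exists_signalProcessing (D : ℕ) (Q R : ℂ[X]) (hQ : Q.natDegree ≤ D) (hR : R.natDegree ≤ D)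
    (h : ∀ z : ℂ, ‖z‖ = 1 → ‖Q.eval z‖ ^ 2 + ‖R.eval z‖ ^ 2 = 1) (k : ℂ) :
    ∃ c : Circuit (Fin n ⊕ Fin 4), c.length = D * (5 * n + 1) + 1 ∧
      (∀ r ≠ (0 : Fin 4), Circuit.Avoids c (.inr r)) ∧
      Circuit.run c (ancState fun _ i => if i = 0 then 0 else k) =
        ancState fun y i => k * if i = 0 then Q.eval (gridPhase y : ℂ)
          else R.eval (gridPhase y : ℂ) := by
  have hav : ∀ (U : Matrix.unitaryGroup (Fin 2) ℂ), ∀ r ≠ (0 : Fin 4),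
      Circuit.Avoids [Gate.single (Sum.inr 0 : Fin n ⊕ Fin 4) U] (.inr r) := fun U r hr g hg => by
    rw [List.mem_singleton.1 hg]
    simpa [Gate.target] using hr.symm
  induction D generalizing Q R with
  | zero =>
    obtain ⟨a, rfl⟩ := natDegree_eq_zero.1 (Nat.le_zero.1 hQ)
    obtain ⟨b, rfl⟩ := natDegree_eq_zero.1 (Nat.le_zero.1 hR)
    have hab := h 1 (by simp)
    simp only [eval_C] at hab
    refine ⟨[.single (.inr 0) (specialUnitary (conj b) (-conj a) (by
      rw [norm_neg, RCLike.norm_conj, RCLike.norm_conj, add_comm, hab]))], by simp, hav _, ?_⟩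
    rw [single_ancState]
    congr 1
    funext y i
    fin_cases i <;> simp [specialUnitary, mul_comm]
  | succ D ih =>
    obtain ⟨U, Q', R', hQ', hR', h', hrec⟩ := exists_layer hQ hR h
    obtain ⟨c, hc, hca, hcr⟩ := ih Q' R' hQ' hR' h'
    refine ⟨c ++ (signalLayer n ++ [.single (.inr 0) U]), ?_, fun r hr => ?_, ?_⟩
    · simp [hc, length_signalLayer]; ring
    · refine (hca r hr).append (Circuit.Avoids.append (Circuit.Avoids.flatMap fun j _ => ?_)
        (hav U r hr))
      exact avoids_cphase _ (by simpa using hr.symm) (by simp) _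
    · rw [Circuit.run_append, Circuit.run_append, hcr, signalLayer_ancState, single_ancState]
      congr 1
      funext y i
      obtain ⟨h0, h1⟩ := hrec (gridPhase y : ℂ)
      fin_cases i
      · simp [h0]; ring
      · simp [h1]; ring

/-- Hadamard gates on the qubits of `l` spread a basis state uniformly. -/
theorem run_hadamards {ι : Type} [Fintype ι] [DecidableEq ι] (l : List ι) (hl : l.Nodup)
    (σ : ι → Fin 2) (hσ : ∀ r ∈ l, σ r = 0) (s : ι → Fin 2) :
    Circuit.run (l.map hadamard) (ket σ) s =
      if ∀ r ∉ l, s r = σ r then (((√2 : ℝ) : ℂ)⁻¹) ^ l.length else 0 := by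
  induction l using List.reverseRecOn generalizing s with
  | nil =>
    simp [Circuit.run_nil, ket, Pi.single_apply, funext_iff]
  | append_singleton l r ih =>
    have hnd := List.nodup_append.1 hl
    have hr : r ∉ l := fun h => hnd.2.2 r h r (by simp) rfl
    have hσr : σ r = 0 := hσ r (by simp)
    have hne : ∀ {r'}, r' ∉ l ++ [r] → r' ≠ r := fun h h' => h (by simp [h'])
    have h1 : ¬ ∀ r' ∉ l, Function.update s r 1 r' = σ r' := fun h => by
      simpa [hσr] using h r hr
    have h0 : (∀ r' ∉ l, Function.update s r 0 r' = σ r') ↔ ∀ r' ∉ l ++ [r], s r' = σ r' := by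
      constructor
      · intro h r' hr'
        have := h r' (fun h' => hr' (by simp [h']))
        rwa [Function.update_of_ne (hne hr')] at this
      · intro h r' hr'
        by_cases hrr : r' = r
        · simp [hrr, hσr]
        · rw [Function.update_of_ne hrr]
          exact h r' (by simp [hr', hrr])
    rw [List.map_append, Circuit.run_append, List.map_singleton, Circuit.run_cons, Circuit.run_nil,
      hadamard_apply, ih hnd.1 (fun r hr => hσ r (by simp [hr])),
      ih hnd.1 (fun r hr => hσ r (by simp [hr])), if_neg h1, mul_zero, add_zero, List.length_append,
      List.length_singleton, pow_succ', mul_ite, mul_zero]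
    exact if_congr h0 rfl rfl

end SignalProcessing

/-! ### Amplitude amplification -/

section Amplification

variable {ι : Type} [DecidableEq ι] [Fintype ι]

/-- Amplitude amplification. Let `g` be the part of the state `A |σ⟩` where qubit `q` is `0`, with
squared norm `sin² θ`, and let `R` act on `|σ⟩` and `A⁻¹ g` as the reflection in `|σ⟩`. Each round
rotates by `2θ` in the plane spanned by `g` and the remaining part of `A |σ⟩`. -/
theorem exists_amplification {A R : Circuit ι} {q : ι} {σ : ι → Fin 2} {g : StateVec ι} {θ : ℝ}
    (hg : ∀ s, g s = if s q = 0 then Circuit.run A (ket σ) s else 0)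
    (hR : Circuit.run R (ket σ) = -ket σ)
    (hRg : Circuit.run R (Circuit.run (Circuit.inv A) g) = Circuit.run (Circuit.inv A) g -
      (2 * Circuit.run (Circuit.inv A) g σ) • ket σ)
    (hp : star g ⬝ᵥ g = ((Real.sin θ ^ 2 : ℝ) : ℂ)) (hsin : Real.sin θ ≠ 0) (hcos : Real.cos θ ≠ 0)
    (m : ℕ) :
    ∃ c : Circuit ι, c.length = m * (2 * A.length + R.length + 1) ∧
      Circuit.run c (Circuit.run A (ket σ)) =
        ((Real.sin ((2 * m + 1) * θ) / Real.sin θ : ℝ) : ℂ) • g +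
        ((Real.cos ((2 * m + 1) * θ) / Real.cos θ : ℝ) : ℂ) • (Circuit.run A (ket σ) - g) := by
  set S := Circuit.run A (ket σ) with hS
  have hinv : Circuit.run (Circuit.inv A) S = ket σ := Circuit.run_inv_run A _
  have hpp : Circuit.run (Circuit.inv A) g σ = ((Real.sin θ ^ 2 : ℝ) : ℂ) := by
    rw [Circuit.run_inv_apply, ← hp]
    refine Finset.sum_congr rfl fun s _ => ?_
    simp only [Pi.star_apply, hg]
    split_ifs <;> simp [hS]
  -- one round; the sign of the phase gate absorbs the usual global sign of the iterate
  set G : Circuit ι := [phase q 1 (-1)] ++ (Circuit.inv A ++ (R ++ A)) with hG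
  have hGrun : ∀ x y : ℂ, Circuit.run G (x • g + y • (S - g)) =
      (x + 2 * y - 2 * ((Real.sin θ ^ 2 : ℝ) : ℂ) * (x + y)) • g +
        (y - 2 * ((Real.sin θ ^ 2 : ℝ) : ℂ) * (x + y)) • (S - g) := fun x y => by
    have h1 : Circuit.run [phase q 1 (-1)] (x • g + y • (S - g)) = (x + y) • g + (-y) • S := by
      funext s
      rw [isDiag_phase]
      simp only [Pi.add_apply, Pi.smul_apply, Pi.sub_apply, hg, smul_eq_mul]
      split_ifs <;> simp
      ring
    rw [hG, Circuit.run_append, Circuit.run_append, Circuit.run_append, h1, Circuit.run_add,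
      Circuit.run_smul, Circuit.run_smul, hinv, Circuit.run_add, Circuit.run_smul,
      Circuit.run_smul, hR, hRg, hpp,
      show (x + y) • (Circuit.run (Circuit.inv A) g - (2 * ((Real.sin θ ^ 2 : ℝ) : ℂ)) • ket σ) +
        (-y) • (-ket σ) = (x + y) • Circuit.run (Circuit.inv A) g +
          (y - 2 * ((Real.sin θ ^ 2 : ℝ) : ℂ) * (x + y)) • ket σ by module,
      Circuit.run_add, Circuit.run_smul, Circuit.run_smul, Circuit.run_run_inv, ← hS]
    module
  induction m with
  | zero =>
    refine ⟨[], by simp, ?_⟩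
    simp [Circuit.run_nil, div_self hsin, div_self hcos]
  | succ m ih =>
    obtain ⟨c, hc, hrun⟩ := ih
    refine ⟨c ++ G, ?_, ?_⟩
    · simp [hc, hG, Circuit.length_inv]; ring
    · rw [Circuit.run_append, hrun, hGrun]
      have e : (2 * ((m + 1 : ℕ) : ℝ) + 1) * θ = (2 * m + 1) * θ + 2 * θ := by push_cast; ring
      have hsc := Real.sin_sq_add_cos_sq θ
      rw [e, Real.sin_add, Real.cos_add, Real.sin_two_mul, Real.cos_two_mul, ← Complex.ofReal_ofNat]
      generalize Real.sin ((2 * m + 1) * θ) = a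
      generalize Real.cos ((2 * m + 1) * θ) = b
      simp only [← Complex.ofReal_mul, ← Complex.ofReal_add, ← Complex.ofReal_sub]
      congr 3
      · field_simp
        linear_combination (-2 * a * Real.cos θ - 2 * b * Real.sin θ ) * hsc
      · field_simp
        linear_combination (-2 * b) * hsc

end Amplification

/-! ### Trace distance of pure states -/

section TraceDistance

open Matrix ComplexOrder

variable {ι : Type} [Fintype ι] [DecidableEq ι]

/-- The trace norm of a matrix of rank at most `2` is bounded through the Cauchy–Schwarz inequality
for its at most two nonzero singular values. -/
theorem traceNorm_le_of_rank_le_two {A : Matrix ι ι ℂ} (h : A.rank ≤ 2) :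
    traceNorm A ≤ √(2 * (Aᴴ * A).trace.re) := by
  set hA := isHermitian_conjTranspose_mul_self A
  have hnn : ∀ i, 0 ≤ hA.eigenvalues i := (posSemidef_conjTranspose_mul_self A).eigenvalues_nonneg
  have hcard : (Finset.univ.filter fun i => hA.eigenvalues i ≠ 0).card ≤ 2 := by
    rw [← Fintype.card_subtype, ← hA.rank_eq_card_non_zero_eigs, rank_conjTranspose_mul_self]
    exact h
  refine Real.le_sqrt_of_sq_le ?_
  have hs : traceNorm A = ∑ i ∈ Finset.univ.filter fun i => hA.eigenvalues i ≠ 0,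
      √(hA.eigenvalues i) := by
    rw [Finset.sum_filter_of_ne]
    · rfl
    · intro i _ hi h0
      exact hi (by rw [h0, Real.sqrt_zero])
  rw [hs]
  refine sq_sum_le_card_mul_sum_sq.trans ?_
  have htr : (Aᴴ * A).trace.re = ∑ i, hA.eigenvalues i := by
    rw [hA.trace_eq_sum_eigenvalues]
    simp
  rw [htr]
  refine mul_le_mul (by exact_mod_cast hcard) ?_ (Finset.sum_nonneg fun i _ => sq_nonneg _) (by simp)
  refine (Finset.sum_le_univ_sum_of_nonneg fun i => sq_nonneg _).trans
    (Finset.sum_le_sum fun i _ => (Real.sq_sqrt (hnn i)).le)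

/-- The trace distance of unit vectors is at most the norm of the component of `φ` orthogonal
to `ψ`. -/
theorem traceDist_le {ψ φ : ι → ℂ} (hψ : star ψ ⬝ᵥ ψ = 1) (hφ : star φ ⬝ᵥ φ = 1) :
    traceDist ψ φ ≤ √(1 - ‖star ψ ⬝ᵥ φ‖ ^ 2) := by
  set A := vecMulVec ψ (star ψ) - vecMulVec φ (star φ) with hA
  have hrank : A.rank ≤ 2 := by
    have hBC : A = (of fun i (k : Fin 2) => ![ψ i, φ i] k) *
        (of fun (k : Fin 2) j => ![star (ψ j), -star (φ j)] k) := by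
      ext i j
      simp [hA, mul_apply, vecMulVec_apply, sub_eq_add_neg]
    rw [hBC]
    exact (rank_mul_le_left _ _).trans ((rank_le_card_width _).trans (by simp))
  have hherm : Aᴴ = A := by
    rw [hA, conjTranspose_sub, conjTranspose_vecMulVec, conjTranspose_vecMulVec, star_star,
      star_star]
  have hc : star φ ⬝ᵥ ψ = star (star ψ ⬝ᵥ φ) := by
    rw [star_dotProduct, dotProduct_comm]
  have htr : (Aᴴ * A).trace.re = 2 * (1 - ‖star ψ ⬝ᵥ φ‖ ^ 2) := by
    have hx : (star ψ ⬝ᵥ φ) * (star φ ⬝ᵥ ψ) = ((‖star ψ ⬝ᵥ φ‖ ^ 2 : ℝ) : ℂ) := by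
      rw [hc, ← Complex.normSq_eq_norm_sq, ← Complex.mul_conj]; rfl
    have : (Aᴴ * A).trace = ((2 * (1 - ‖star ψ ⬝ᵥ φ‖ ^ 2) : ℝ) : ℂ) := by
      rw [hherm, hA, sub_mul, mul_sub, mul_sub]
      simp only [vecMulVec_mul_vecMulVec, trace_sub, trace_vecMulVec, hψ, hφ, dotProduct_smul,
        dotProduct_comm _ (star ψ), dotProduct_comm _ (star φ), smul_eq_mul]
      push_cast at hx ⊢
      linear_combination (-2 : ℂ) * hx
    rw [this, Complex.ofReal_re]
  have := traceNorm_le_of_rank_le_two hrank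
  rw [htr, ← mul_assoc, show (2 : ℝ) * 2 = 2 ^ 2 by norm_num, Real.sqrt_mul (by norm_num),
    Real.sqrt_sq zero_le_two] at this
  rw [traceDist]
  linarith

/-- If the vector `v` is within distance `ε ‖v‖` of `u`, then the sine of the angle between `u` and
`v` is at most `ε`: the component of `v` orthogonal to `u` is no longer than `v - u`. -/
theorem one_sub_normSq_le {u v : ι → ℂ} {a b ε : ℝ} (ha : 0 < a) (hb : 0 < b)
    (hu : ∑ i, ‖u i‖ ^ 2 = a ^ 2) (hv : ∑ i, ‖v i‖ ^ 2 = b ^ 2)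
    (h : ∑ i, ‖u i - v i‖ ^ 2 ≤ (ε * b) ^ 2) :
    1 - ‖star (fun i => u i / (a : ℂ)) ⬝ᵥ (fun i => v i / (b : ℂ))‖ ^ 2 ≤ ε ^ 2 := by
  set c : ℂ := star u ⬝ᵥ v with hc
  have e1 : star (fun i => u i / (a : ℂ)) ⬝ᵥ (fun i => v i / (b : ℂ)) = c / (a * b) := by
    rw [hc, dotProduct, dotProduct, Finset.sum_div]
    refine Finset.sum_congr rfl fun i _ => ?_
    simp [div_mul_div_comm]
  have e2 : ∑ i, ‖u i - v i‖ ^ 2 = a ^ 2 + b ^ 2 - 2 * c.re := by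
    rw [← hu, ← hv, hc, dotProduct, Complex.re_sum, Finset.mul_sum, ← Finset.sum_add_distrib,
      ← Finset.sum_sub_distrib]
    refine Finset.sum_congr rfl fun i _ => ?_
    simp only [← Complex.normSq_eq_norm_sq, Complex.normSq_apply, Pi.star_apply, Complex.star_def,
      Complex.mul_re, Complex.sub_re, Complex.sub_im, Complex.conj_re, Complex.conj_im]
    ring
  have e3 : c.re ^ 2 ≤ ‖c‖ ^ 2 := by
    rw [← Complex.normSq_eq_norm_sq, Complex.normSq_apply]
    nlinarith [sq_nonneg c.im]
  rw [e1, norm_div, norm_mul, Complex.norm_real, Complex.norm_real, Real.norm_of_nonneg ha.le,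
    Real.norm_of_nonneg hb.le, div_pow, mul_pow]
  rw [sub_le_iff_le_add, ← sub_le_iff_le_add', le_div_iff₀ (by positivity)]
  refine le_trans ?_ e3
  rw [e2] at h
  nlinarith [sq_nonneg (a ^ 2 - c.re), mul_le_mul_of_nonneg_left h (sq_nonneg a)]

end TraceDistance

/-! ### The state preparation circuit -/

section Preparation

open Polynomial ComplexConjugate

/-- The polynomial `z ^ d * P ((z - z⁻¹) / 2i)`; on the unit circle the argument of `P` is a
sine. -/
def sinPoly (d : ℕ) (P : ℂ[X]) : ℂ[X] :=
  ∑ k ∈ Finset.range (d + 1), C (P.coeff k) * (X ^ (d - k) * (C (2 * Complex.I)⁻¹ * (X ^ 2 - 1)) ^ k)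

theorem natDegree_sinPoly_le (d : ℕ) (P : ℂ[X]) : (sinPoly d P).natDegree ≤ 2 * d := by
  refine natDegree_sum_le_of_forall_le _ _ fun k hk => ?_
  have hk' : k ≤ d := Nat.lt_succ_iff.1 (Finset.mem_range.1 hk)
  refine (natDegree_C_mul_le _ _).trans (natDegree_mul_le.trans ?_)
  have h2 : (C (2 * Complex.I)⁻¹ * (X ^ 2 - 1) : ℂ[X]).natDegree ≤ 2 :=
    (natDegree_C_mul_le _ _).trans ((natDegree_sub_le _ _).trans (by simp))
  have h3 := (natDegree_pow_le (p := (C (2 * Complex.I)⁻¹ * (X ^ 2 - 1) : ℂ[X])) (n := k)).trans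
    (Nat.mul_le_mul_left k h2)
  rw [natDegree_X_pow]
  omega

theorem eval_sinPoly {d : ℕ} {P : ℂ[X]} (hP : P.natDegree ≤ d) (t : ℝ) :
    (sinPoly d P).eval (Circle.exp t : ℂ) =
      (Circle.exp t : ℂ) ^ d * P.eval ((Real.sin t : ℝ) : ℂ) := by
  have hz : (Circle.exp t : ℂ) ≠ 0 := Circle.coe_ne_zero _
  have hs : (2 * Complex.I)⁻¹ * ((Circle.exp t : ℂ) ^ 2 - 1) =
      (Circle.exp t : ℂ) * ((Real.sin t : ℝ) : ℂ) := by
    have hinv : (Circle.exp t : ℂ)⁻¹ = Complex.exp (-(t * Complex.I)) := by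
      rw [Circle.coe_exp, ← Complex.exp_neg]
    rw [Complex.ofReal_sin, Complex.sin, neg_mul, ← hinv, ← Circle.coe_exp]
    field_simp
    linear_combination ((Circle.exp t : ℂ) ^ 2 - 1) * Complex.I_sq
  rw [sinPoly, eval_finsetSum, eval_eq_sum_range' (Nat.lt_succ_of_le hP), Finset.mul_sum]
  refine Finset.sum_congr rfl fun k hk => ?_
  have hk' : k ≤ d := Nat.lt_succ_iff.1 (Finset.mem_range.1 hk)
  simp only [eval_mul, eval_C, eval_pow, eval_X, eval_sub, eval_one, hs]
  rw [mul_pow, ← Nat.sub_add_cancel hk', pow_add, Nat.add_sub_cancel]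
  ring

variable {n : ℕ}

theorem sum_ancState (h : (Fin n → Fin 2) → ℂ) :
    ∑ s, ancState (fun y i => if i = 0 then h y else 0) s = ∑ y, h y := by
  rw [← (Equiv.sumArrowEquivProdArrow (Fin n) (Fin 4) (Fin 2)).symm.sum_comp,
    Fintype.sum_prod_type]
  refine Finset.sum_congr rfl fun y _ => ?_
  rw [Finset.sum_eq_single (fun _ => 0)]
  · simp [ancState, Equiv.sumArrowEquivProdArrow]
  · intro a _ ha
    have : ¬ (a 0 = 0 ∧ a 1 = 0 ∧ a 2 = 0 ∧ a 3 = 0) := fun h => ha (by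
      funext i; fin_cases i <;> simp [h])
    exact ite_eq_right_iff.2 fun h1 => ite_eq_right_iff.2 fun h2 => absurd ⟨h2, h1⟩ this
  · simp

theorem withAncillas_eq (ψ : Fin (2 ^ n) → ℂ) :
    withAncillas 4 ψ = ancState fun y i => if i = 0 then ψ (finFunctionFinEquiv y) else 0 := by
  funext s
  have hb : ∀ x, s = basisBits n 4 x ↔ x = finFunctionFinEquiv (s ∘ Sum.inl) ∧
      (s (.inr 1) = 0 ∧ s (.inr 2) = 0 ∧ s (.inr 3) = 0) ∧ s (.inr 0) = 0 := fun x => by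
    constructor
    · rintro rfl
      refine ⟨?_, by simp [basisBits]⟩
      have : (basisBits n 4 x) ∘ Sum.inl = finFunctionFinEquiv.symm x := rfl
      rw [this, Equiv.apply_symm_apply]
    · rintro ⟨rfl, ⟨h1, h2, h3⟩, h0⟩
      funext r
      rcases r with r | r
      · simp [basisBits]
      · fin_cases r <;> simp [basisBits, h0, h1, h2, h3]
  simp only [withAncillas, Finset.sum_apply, Pi.smul_apply, ket, Pi.single_apply, hb, smul_eq_mul,
    ancState, mul_ite, mul_one, mul_zero, ite_and]
  rw [Finset.sum_ite_eq']
  simp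

/-- The initial basis state of the amplification: the first ancilla is `1`, all other qubits are
`0`. -/
def startBits (n : ℕ) : Fin n ⊕ Fin 4 → Fin 2 := Sum.elim (fun _ => 0) ![1, 0, 0, 0]

/-- The first ancilla is flipped by the matrix with rows `(0, -1)` and `(1, 0)`. -/
theorem run_not_ket :
    Circuit.run [.single (.inr 0) (specialUnitary 0 1 (by simp))]
      (ket (fun _ => 0) : StateVec (Fin n ⊕ Fin 4)) = ket (startBits n) := by
  funext s
  have h : ∀ i : Fin 2, Function.update s (.inr 0) i = (fun _ => 0) ↔
      i = 0 ∧ ∀ r, r ≠ .inr 0 → s r = 0 := fun i => by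
    rw [Function.update_eq_iff]
  have h' : s = startBits n ↔ s (.inr 0) = 1 ∧ ∀ r, r ≠ .inr 0 → s r = 0 := by
    constructor
    · rintro rfl
      refine ⟨rfl, fun r hr => ?_⟩
      rcases r with r | r
      · rfl
      · fin_cases r
        · exact absurd rfl hr
        all_goals rfl
    · rintro ⟨h0, h⟩
      funext r
      rcases r with r | r
      · simpa [startBits] using h (.inl r) (by simp)
      · fin_cases r
        · simpa [startBits] using h0
        all_goals simpa [startBits] using h (.inr _) (by simp)
  rw [Circuit.run_cons, Circuit.run_nil]
  simp only [Gate.apply, ket, Pi.single_apply, h, h', Fin.sum_univ_two]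
  rcases fin_two_cases (s (.inr 0)) with hs | hs <;> simp [hs, specialUnitary]

theorem run_hadamards_start :
    Circuit.run ((List.finRange n).map fun j => hadamard (.inl j)) (ket (startBits n)) =
      ancState fun _ i => if i = 0 then 0 else (((√2 : ℝ) : ℂ)⁻¹) ^ n := by
  funext s
  have := run_hadamards ((List.finRange n).map (Sum.inl : Fin n → Fin n ⊕ Fin 4))
    ((List.nodup_finRange n).map Sum.inl_injective) (startBits n) (by simp [startBits]) s
  rw [List.map_map] at this
  rw [show (fun j => hadamard (.inl j) : Fin n → Gate (Fin n ⊕ Fin 4)) = hadamard ∘ Sum.inl from rfl,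
    this, List.length_map, List.length_finRange, ancState]
  have hc : (∀ r ∉ (List.finRange n).map (Sum.inl : Fin n → Fin n ⊕ Fin 4), s r = startBits n r) ↔
      (s (.inr 1) = 0 ∧ s (.inr 2) = 0 ∧ s (.inr 3) = 0) ∧ s (.inr 0) = 1 := by
    simp [Sum.forall, Fin.forall_fin_succ, startBits]
    tauto
  simp only [hc, ite_and]
  congr 1
  rcases fin_two_cases (s (.inr 0)) with hs | hs <;> simp [hs]

/-- The reflection that flips the sign of `startBits` among the states with clean ancillas. -/
theorem exists_start_reflection (n : ℕ) :
    ∃ R : Circuit (Fin n ⊕ Fin 4), R.length ≤ 304 * (n + 2) + 2 ∧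
      Circuit.run R (ket (startBits n)) = -ket (startBits n) ∧
      ∀ φ, (∀ s, s (.inr 1) ≠ 0 → φ s = 0) → (∀ s, s (.inr 2) ≠ 0 → φ s = 0) →
        Circuit.run R φ = φ - (2 * φ (startBits n)) • ket (startBits n) := by
  set A : List (Fin n ⊕ Fin 4) := ((List.finRange n).take (n / 2)).map Sum.inl with hA
  set B : List (Fin n ⊕ Fin 4) := ((List.finRange n).drop (n / 2)).map Sum.inl with hB
  have hAB : A ++ B = (List.finRange n).map Sum.inl := by
    rw [hA, hB, ← List.map_append, List.take_append_drop]
  have hAl : A.length = n / 2 := by simp [hA]; omega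
  have hBl : B.length = n - n / 2 := by simp [hB]
  obtain ⟨R, hR, hD⟩ := exists_reflection (q := .inr 0) (t := .inr 1) (u := .inr 2) (w := .inr 3)
    (A := A) (B := B) (by
      rw [hAB]
      have := (List.nodup_finRange n).map (Sum.inl_injective (α := Fin n) (β := Fin 4))
      simp [this]) (by omega) (by omega)
  rw [hAB] at hD
  have hs : ∀ s : Fin n ⊕ Fin 4 → Fin 2, s = startBits n ↔ (s (.inr 0) = 1 ∧ s (.inr 3) = 0 ∧
      ∀ r ∈ (List.finRange n).map (Sum.inl : Fin n → Fin n ⊕ Fin 4), s r = 0) ∧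
        s (.inr 1) = 0 ∧ s (.inr 2) = 0 := fun s => by
    simp [funext_iff, Sum.forall, Fin.forall_fin_succ, startBits]
    tauto
  refine ⟨R, by omega, ?_, fun φ h1 h2 => ?_⟩
  · funext s
    rw [hD]
    beta_reduce
    by_cases h : s = startBits n
    · rw [if_pos ((hs s).1 h).1]
      simp
    · simp [ket, h]
  · funext s
    rw [hD]
    beta_reduce
    simp only [Pi.sub_apply, Pi.smul_apply, ket, Pi.single_apply, smul_eq_mul]
    by_cases h : s = startBits n
    · rw [if_pos ((hs s).1 h).1, if_pos h, h]
      ring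
    · rw [if_neg h, mul_zero, sub_zero]
      by_cases h1' : s (.inr 1) = 0
      · by_cases h2' : s (.inr 2) = 0
        · rw [if_neg (fun h' => h ((hs s).2 ⟨h', h1', h2'⟩)), one_mul]
        · rw [h2 s h2', mul_zero]
      · rw [h1 s h1', mul_zero]

/-- The block encoding: a circuit after which the amplitudes on first ancilla `0` are
`k * P (sin (x / N)) / √N`. -/
theorem exists_blockEncoding (n : ℕ) {d : ℕ} {P : ℂ[X]} (hP : P.natDegree ≤ d) (k : ℝ)
    (hlt : ∀ y ∈ Set.Icc (-1 : ℝ) 1, ‖(k : ℂ) * P.eval (y : ℂ)‖ < 1) :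
    ∃ (A : Circuit (Fin n ⊕ Fin 4)) (v : (Fin n → Fin 2) → ℂ),
      A.length = 2 * d * (5 * n + 1) + 1 + 2 * n ∧
      (∀ r ≠ (0 : Fin 4), Circuit.Avoids A (.inr r)) ∧
      Circuit.run A (ket (startBits n)) = ancState fun y i => if i = 0 then
        (((√2 : ℝ) : ℂ)⁻¹) ^ n * (k * P.eval
          ((Real.sin (((finFunctionFinEquiv y : Fin (2 ^ n)) : ℕ) / 2 ^ n) : ℝ) : ℂ)) else v y := by
  obtain ⟨R, hR, hQR⟩ := exists_complement (2 * d) (C (k : ℂ) * sinPoly d P)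
    ((natDegree_C_mul_le _ _).trans (natDegree_sinPoly_le d P)) (fun z hz => by
      obtain ⟨t, ht⟩ : ∃ t : ℝ, (Circle.exp t : ℂ) = z := ⟨z.arg, by
        rw [Circle.coe_exp]
        simpa [hz] using Complex.norm_mul_exp_arg_mul_I z⟩
      rw [← ht, eval_mul, eval_C, eval_sinPoly hP]
      have := hlt (Real.sin t) ⟨Real.neg_one_le_sin t, Real.sin_le_one t⟩
      simpa using this)
  obtain ⟨c, hc, hca, hcr⟩ := exists_signalProcessing (n := n) (2 * d) _ R
    ((natDegree_C_mul_le _ _).trans (natDegree_sinPoly_le d P)) hR hQR ((((√2 : ℝ) : ℂ)⁻¹) ^ n)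
  refine ⟨(List.finRange n).map (fun j => hadamard (.inl j)) ++ (c ++ phaseLayer n d),
    fun y => ((gridPhase y : ℂ) ^ d)⁻¹ * ((((√2 : ℝ) : ℂ)⁻¹) ^ n * R.eval (gridPhase y : ℂ)),
    ?_, fun r hr => ?_, ?_⟩
  · simp [hc, length_phaseLayer]; ring
  · refine Circuit.Avoids.append ?_ ((hca r hr).append (Circuit.Avoids.flatMap fun j _ =>
      avoids_phase (by simp) _ _))
    intro g hg
    obtain ⟨j, -, rfl⟩ := List.mem_map.1 hg
    simp [hadamard, Gate.target]
  · rw [Circuit.run_append, Circuit.run_append, run_hadamards_start, hcr, phaseLayer_ancState]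
    congr 1
    funext y i
    have hz : (gridPhase y : ℂ) ≠ 0 := Circle.coe_ne_zero _
    split_ifs with hi
    · rw [gridPhase] at hz ⊢
      rw [eval_mul, eval_C, eval_sinPoly hP]
      field_simp
    · rfl

/-- Exact preparation of the normalised state with amplitudes proportional to `P (sin (x / N))`
from a bound `B` on `P`. The block encoding is scaled so that the success amplitude is the sine of
`π / (2 (2 m + 1))`, whence `m` rounds of amplification are exact; the number `m` is proportional
to `B` over the root mean square of the amplitudes. -/
theorem exists_preparation {n d : ℕ} (hn : 1 ≤ n) (hd : 1 ≤ d) {P : ℂ[X]} (hP : P.natDegree ≤ d)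
    {B μ : ℝ} (hμ : 0 < μ) (hμB : μ ≤ B)
    (hB : ∀ y ∈ Set.Icc (-1 : ℝ) 1, ‖P.eval (y : ℂ)‖ ≤ B)
    (hsum : ∑ x : Fin (2 ^ n), ‖P.eval ((Real.sin (((x : ℕ) : ℝ) / 2 ^ n) : ℝ) : ℂ)‖ ^ 2 =
      2 ^ n * μ ^ 2) :
    ∃ c : Circuit (Fin n ⊕ Fin 4),
      Circuit.run c (ket (fun _ => 0)) = withAncillas 4 (fun x =>
        P.eval ((Real.sin (((x : ℕ) : ℝ) / 2 ^ n) : ℝ) : ℂ) / ((√(2 ^ n * μ ^ 2) : ℝ) : ℂ)) ∧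
      (c.length : ℝ) ≤ 2000 * (n * d * (B / μ)) := by
  have hBpos : 0 < B := hμ.trans_le hμB
  set m : ℕ := ⌈B / μ⌉₊ with hm
  have hBm : B / μ ≤ m := Nat.le_ceil _
  have hρ : 1 ≤ B / μ := (one_le_div hμ).2 hμB
  have hm1 : (1 : ℝ) ≤ m := hρ.trans hBm
  set θ : ℝ := Real.pi / (2 * (2 * m + 1)) with hθ
  have hpi := Real.pi_pos
  have hθ0 : 0 < θ := by positivity
  -- since `sin θ ≤ θ`, this keeps the scaled polynomial below `1`
  have hθm : θ * m < 1 := by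
    rw [hθ, div_mul_eq_mul_div, div_lt_one (by positivity)]
    nlinarith [Real.pi_lt_four]
  have hθ2 : θ < Real.pi / 2 := by
    rw [hθ]
    exact div_lt_div_of_pos_left hpi two_pos (by linarith)
  have hsin : 0 < Real.sin θ := Real.sin_pos_of_pos_of_lt_pi hθ0 (by linarith)
  have hcos : 0 < Real.cos θ := Real.cos_pos_of_mem_Ioo ⟨by linarith, hθ2⟩
  obtain ⟨A, v, hAl, hAa, hAr⟩ := exists_blockEncoding n hP (Real.sin θ / μ) (fun y hy => by
    rw [norm_mul, Complex.norm_real, Real.norm_of_nonneg (by positivity)]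
    calc Real.sin θ / μ * ‖P.eval (y : ℂ)‖ ≤ θ / μ * B :=
          mul_le_mul (div_le_div_of_nonneg_right (Real.sin_le hθ0.le) hμ.le) (hB y hy)
            (norm_nonneg _) (by positivity)
      _ = θ * (B / μ) := by ring
      _ ≤ θ * m := mul_le_mul_of_nonneg_left hBm hθ0.le
      _ < 1 := hθm)
  obtain ⟨R, hRl, hRσ, hRφ⟩ := exists_start_reflection n
  set p : Fin (2 ^ n) → ℂ := fun x => P.eval ((Real.sin (((x : ℕ) : ℝ) / 2 ^ n) : ℝ) : ℂ) with hp
  set a : ℂ := (((√2 : ℝ) : ℂ)⁻¹) ^ n with ha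
  have ha2 : ‖a‖ ^ 2 = (2 ^ n)⁻¹ := by
    rw [ha, norm_pow, norm_inv, Complex.norm_real, Real.norm_of_nonneg (Real.sqrt_nonneg _),
      ← pow_mul, mul_comm, pow_mul, inv_pow, Real.sq_sqrt zero_le_two, inv_pow]
  set g : StateVec (Fin n ⊕ Fin 4) := ancState fun y i => if i = 0 then
    a * (((Real.sin θ / μ : ℝ) : ℂ) * p (finFunctionFinEquiv y)) else 0 with hg
  have hgA : ∀ s, g s = if s (.inr 0) = 0 then Circuit.run A (ket (startBits n)) s else 0 := by
    intro s
    rw [hAr, hg]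
    simp only [ancState]
    split_ifs <;> rfl
  have hgg : star g ⬝ᵥ g = ((Real.sin θ ^ 2 : ℝ) : ℂ) := by
    have h1 : ∀ s, star g s * g s = ancState (fun y i => if i = 0 then
        ((‖a‖ ^ 2 * (Real.sin θ / μ) ^ 2 * ‖p (finFunctionFinEquiv y)‖ ^ 2 : ℝ) : ℂ) else 0) s := by
      intro s
      rw [Pi.star_apply, Complex.star_def, ← Complex.normSq_eq_conj_mul_self, hg]
      simp only [ancState]
      split_ifs
      · rw [Complex.normSq_eq_norm_sq, norm_mul, norm_mul, Complex.norm_real, Real.norm_eq_abs,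
          mul_pow, mul_pow, sq_abs, mul_assoc]
      · simp
      · simp
    rw [dotProduct, Finset.sum_congr rfl fun s _ => h1 s, sum_ancState, ← Complex.ofReal_sum,
      ← Finset.mul_sum, finFunctionFinEquiv.sum_comp (fun x => ‖p x‖ ^ 2), hsum, ha2]
    congr 1
    field_simp
  have hsupp : ∀ r ≠ (0 : Fin 4), ∀ s : Fin n ⊕ Fin 4 → Fin 2, s (.inr r) ≠ 0 → g s = 0 := by
    intro r hr s hs
    rw [hg]
    simp only [ancState]
    refine if_neg fun h => hs ?_
    fin_cases r
    · exact absurd rfl hr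
    exacts [h.1, h.2.1, h.2.2]
  obtain ⟨c, hcl, hcr⟩ := exists_amplification hgA hRσ
    (hRφ _ ((hAa 1 (by decide)).inv.run_eq_zero (hsupp 1 (by decide)))
      ((hAa 2 (by decide)).inv.run_eq_zero (hsupp 2 (by decide)))) hgg hsin.ne' hcos.ne' m
  refine ⟨[.single (.inr 0) (specialUnitary 0 1 (by simp))] ++ (A ++ c), ?_, ?_⟩
  · have hangle : (2 * (m : ℝ) + 1) * θ = Real.pi / 2 := by
      rw [hθ]; field_simp
    rw [Circuit.run_append, Circuit.run_append, run_not_ket, hcr, hangle, Real.sin_pi_div_two,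
      Real.cos_pi_div_two, zero_div, Complex.ofReal_zero, zero_smul, add_zero, withAncillas_eq]
    funext s
    simp only [Pi.smul_apply, hg, ancState, smul_eq_mul, mul_ite, mul_zero]
    have hsq : √(2 ^ n * μ ^ 2) = √2 ^ n * μ := by
      rw [show (2 : ℝ) ^ n * μ ^ 2 = (√2 ^ n * μ) ^ 2 by
        rw [mul_pow, ← pow_mul, mul_comm n 2, pow_mul, Real.sq_sqrt zero_le_two],
        Real.sqrt_sq (by positivity)]
    have hμ' : (μ : ℂ) ≠ 0 := by exact_mod_cast hμ.ne'
    have hs' : ((Real.sin θ : ℝ) : ℂ) ≠ 0 := by exact_mod_cast hsin.ne'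
    have h2 : ((√2 : ℝ) : ℂ) ≠ 0 := by exact_mod_cast (by positivity : √(2 : ℝ) ≠ 0)
    have hval : ∀ x, ((1 / Real.sin θ : ℝ) : ℂ) * (a * (((Real.sin θ / μ : ℝ) : ℂ) * p x)) =
        p x / ((√(2 ^ n * μ ^ 2) : ℝ) : ℂ) := fun x => by
      rw [hsq, ha, inv_pow]
      push_cast [← Complex.ofReal_sin]
      field_simp
    simp only [hval]
    rfl
  · simp only [List.length_append, List.length_singleton, hcl, hAl]
    have hnd1 : n ≤ n * d := Nat.le_mul_of_pos_right n hd
    have hnd2 : d ≤ n * d := Nat.le_mul_of_pos_left d hn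
    have hround : 2 * (2 * d * (5 * n + 1) + 1 + 2 * n) + R.length + 1 ≤ 945 * (n * d) := by
      nlinarith
    have hfirst : 1 + (2 * d * (5 * n + 1) + 1 + 2 * n) ≤ 16 * (n * d) := by nlinarith
    have htot : 1 + (2 * d * (5 * n + 1) + 1 + 2 * n +
        m * (2 * (2 * d * (5 * n + 1) + 1 + 2 * n) + R.length + 1)) ≤
        16 * (n * d) + m * (945 * (n * d)) := by
      have := Nat.mul_le_mul_left m hround
      omega
    have hm2 : (m : ℝ) ≤ 2 * (B / μ) := by
      have := Nat.ceil_lt_add_one (by positivity : 0 ≤ B / μ)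
      linarith
    have hX : (0 : ℝ) ≤ n * d := by positivity
    calc _ ≤ ((16 * (n * d) + m * (945 * (n * d)) : ℕ) : ℝ) := by exact_mod_cast htot
      _ = 16 * ((n * d : ℝ) * 1) + 945 * ((n * d : ℝ) * m) := by push_cast; ring
      _ ≤ 16 * ((n * d : ℝ) * (B / μ)) + 945 * ((n * d : ℝ) * (2 * (B / μ))) := by gcongr
      _ ≤ 2000 * (n * d * (B / μ)) := by nlinarith [mul_nonneg hX (zero_le_one.trans hρ)]

end Preparation

/-! ### Discretised norms -/

section Discretisation

variable {f : ℝ → ℂ} {a b : ℝ}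

theorem gridPoint_mem_Icc (hab : a < b) (n : ℕ) (x : Fin (2 ^ n)) :
    gridPoint a b n x ∈ Set.Icc a b := by
  have h0 : 0 ≤ (((x : ℕ) : ℝ) / 2 ^ n) := by positivity
  have h1 : (((x : ℕ) : ℝ) / 2 ^ n) ≤ 1 := by
    rw [div_le_one (by positivity)]
    exact_mod_cast x.2.le
  have hba : 0 < b - a := sub_pos.2 hab
  rw [gridPoint, mul_div_assoc]
  constructor <;> nlinarith

theorem norm_le_supAbs (hf : BddAbove ((fun t => ‖f t‖) '' Set.Icc a b)) {t : ℝ}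
    (ht : t ∈ Set.Icc a b) : ‖f t‖ ≤ supAbs f a b :=
  le_csSup hf ⟨t, ht, rfl⟩

theorem fillFrac_eq (hab : a < b) (hf : 0 < supAbs f a b) (n : ℕ) :
    fillFrac f a b n = √((∑ x : Fin (2 ^ n), ‖f (gridPoint a b n x)‖ ^ 2) / 2 ^ n) /
      supAbs f a b := by
  have hba : 0 < b - a := sub_pos.2 hab
  rw [fillFrac, discNorm, ← Real.sqrt_div (by positivity), div_mul_eq_mul_div,
    mul_div_assoc, mul_div_mul_left _ _ hba.ne', Real.sqrt_div (by positivity),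
    Real.sqrt_sq hf.le]

theorem sum_normSq_pos {n : ℕ} {x : Fin (2 ^ n)} (hx : f (gridPoint a b n x) ≠ 0) :
    0 < ∑ x : Fin (2 ^ n), ‖f (gridPoint a b n x)‖ ^ 2 :=
  Finset.sum_pos' (fun _ _ => sq_nonneg _) ⟨x, Finset.mem_univ _, pow_pos (norm_pos_iff.2 hx) 2⟩

theorem fillFrac_pos {n : ℕ} (hab : a < b) (hf : 0 < supAbs f a b)
    (h : 0 < ∑ x : Fin (2 ^ n), ‖f (gridPoint a b n x)‖ ^ 2) : 0 < fillFrac f a b n := by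
  rw [fillFrac_eq hab hf]
  exact div_pos (Real.sqrt_pos.2 (div_pos h (by positivity))) hf

theorem sum_normSq_eq (hab : a < b) (hf : 0 < supAbs f a b) (n : ℕ) :
    ∑ x : Fin (2 ^ n), ‖f (gridPoint a b n x)‖ ^ 2 =
      2 ^ n * (fillFrac f a b n * supAbs f a b) ^ 2 := by
  rw [fillFrac_eq hab hf, div_mul_cancel₀ _ hf.ne', Real.sq_sqrt (by positivity)]
  field_simp

/-- Closeness of the rescaled amplitudes gives closeness of the normalised states. -/
theorem traceDist_stateOf_le {g : ℝ → ℂ} {n : ℕ} {ε : ℝ} (hab : a < b) (hε : 0 ≤ ε)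
    (hf : 0 < supAbs f a b) (hF : 0 < fillFrac f a b n)
    (hg : 0 < ∑ x : Fin (2 ^ n), ‖g (gridPoint a b n x)‖ ^ 2)
    (h : ∀ x : Fin (2 ^ n), ‖g (gridPoint a b n x) -
      f (gridPoint a b n x) / ((supAbs f a b : ℝ) : ℂ)‖ ≤ ε * fillFrac f a b n) :
    traceDist (stateOf g a b n) (stateOf f a b n) ≤ ε := by
  set S := supAbs f a b with hS
  set u : Fin (2 ^ n) → ℂ := fun x => g (gridPoint a b n x) with hu
  set v : Fin (2 ^ n) → ℂ := fun x => f (gridPoint a b n x) / (S : ℂ) with hv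
  have hfs := sum_normSq_eq hab hf n
  rw [← hS] at hfs
  have hvs : ∑ x, ‖v x‖ ^ 2 = 2 ^ n * fillFrac f a b n ^ 2 := by
    simp only [hv, norm_div, Complex.norm_real, Real.norm_of_nonneg hf.le, div_pow]
    rw [← Finset.sum_div, hfs]
    field_simp
  have hvpos : 0 < ∑ x, ‖v x‖ ^ 2 := by rw [hvs]; positivity
  have hSC : (S : ℂ) ≠ 0 := by exact_mod_cast hf.ne'
  have hfv : stateOf f a b n = fun x => v x / ((√(∑ x, ‖v x‖ ^ 2) : ℝ) : ℂ) := by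
    have hr : √(∑ x, ‖f (gridPoint a b n x)‖ ^ 2) = S * √(∑ x, ‖v x‖ ^ 2) := by
      rw [hfs, hvs, mul_pow, ← mul_assoc, Real.sqrt_mul (by positivity), Real.sqrt_sq hf.le,
        mul_comm]
    funext x
    rw [stateOf, hr, hv]
    push_cast
    field_simp
  have hgu : stateOf g a b n = fun x => u x / ((√(∑ x, ‖u x‖ ^ 2) : ℝ) : ℂ) := rfl
  have hunit : ∀ w : Fin (2 ^ n) → ℂ, 0 < ∑ x, ‖w x‖ ^ 2 →
      star (fun x => w x / ((√(∑ x, ‖w x‖ ^ 2) : ℝ) : ℂ)) ⬝ᵥ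
        (fun x => w x / ((√(∑ x, ‖w x‖ ^ 2) : ℝ) : ℂ)) = 1 := fun w hw => by
    have h1 : ∀ x, star (w x / ((√(∑ x, ‖w x‖ ^ 2) : ℝ) : ℂ)) *
        (w x / ((√(∑ x, ‖w x‖ ^ 2) : ℝ) : ℂ)) =
        ((‖w x‖ ^ 2 / ∑ x, ‖w x‖ ^ 2 : ℝ) : ℂ) := fun x => by
      rw [Complex.star_def, ← Complex.normSq_eq_conj_mul_self, Complex.normSq_eq_norm_sq, norm_div,
        Complex.norm_real, Real.norm_of_nonneg (Real.sqrt_nonneg _), div_pow, Real.sq_sqrt hw.le]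
    simp only [dotProduct, Pi.star_apply, h1]
    rw [← Complex.ofReal_sum, ← Finset.sum_div, div_self hw.ne', Complex.ofReal_one]
  rw [hgu, hfv]
  refine (traceDist_le (hunit u hg) (hunit v hvpos)).trans ?_
  rw [Real.sqrt_le_left hε]
  refine one_sub_normSq_le (Real.sqrt_pos.2 hg) (Real.sqrt_pos.2 hvpos)
    (Real.sq_sqrt hg.le).symm (Real.sq_sqrt hvpos.le).symm ?_
  rw [mul_pow, Real.sq_sqrt hvpos.le, hvs]
  calc ∑ x, ‖u x - v x‖ ^ 2 ≤ ∑ _x : Fin (2 ^ n), (ε * fillFrac f a b n) ^ 2 :=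
        Finset.sum_le_sum fun x _ => pow_le_pow_left₀ (norm_nonneg _) (h x) 2
    _ = ε ^ 2 * (2 ^ n * fillFrac f a b n ^ 2) := by
        rw [Finset.sum_const, Finset.card_univ, Fintype.card_fin, nsmul_eq_mul]
        push_cast
        ring

end Discretisation

end QPrep

end

theorem theorem1 :
    ∃ C : ℝ, 0 < C ∧
      ∀ (n d : ℕ) (a b : ℝ) (f : ℝ → ℂ) (P : Polynomial ℂ) (K ε : ℝ),
        1 ≤ n → 1 ≤ d → a < b →
        BddAbove ((fun t => ‖f t‖) '' Set.Icc a b) →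
        (∃ x : Fin (2 ^ n), f (QPrep.gridPoint a b n x) ≠ 0) →
        P.natDegree ≤ d →
        (∀ y : ℝ, y ∈ Set.Icc (-1 : ℝ) 1 →
          ‖P.eval (y : ℂ)‖ ≤ K * QPrep.supAbs (QPrep.polySin P a b) a b) →
        0 ≤ ε →
        (∀ x : Fin (2 ^ n),
          ‖P.eval ((Real.sin (((x : ℕ) : ℝ) / 2 ^ n) : ℝ) : ℂ) -
              f (QPrep.gridPoint a b n x) / ((QPrep.supAbs f a b : ℝ) : ℂ)‖ ≤
            ε * min (QPrep.fillFrac f a b n) (QPrep.fillFrac (QPrep.polySin P a b) a b n)) →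
        QPrep.traceDist (QPrep.stateOf (QPrep.polySin P a b) a b n) (QPrep.stateOf f a b n) ≤ ε ∧
        ∃ c : QPrep.Circuit (Fin n ⊕ Fin 4),
          c.run (QPrep.ket (fun _ => 0)) =
            QPrep.withAncillas 4 (QPrep.stateOf (QPrep.polySin P a b) a b n) ∧
          (c.length : ℝ) ≤
            C * K * ((n : ℝ) * (d : ℝ) / QPrep.fillFrac (QPrep.polySin P a b) a b n) := by
  refine ⟨2000, by norm_num, ?_⟩
  intro n d a b f P K ε hn hd hab hf hfx hP hK hε h
  obtain ⟨x₀, hx₀⟩ := hfx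
  set F : ℝ → ℂ := QPrep.polySin P a b with hF
  have hgrid := fun x => QPrep.gridPoint_mem_Icc hab n x
  have hsup : 0 < QPrep.supAbs f a b :=
    (norm_pos_iff.2 hx₀).trans_le (QPrep.norm_le_supAbs hf (hgrid x₀))
  have hval : ∀ x : Fin (2 ^ n), F (QPrep.gridPoint a b n x) =
      P.eval ((Real.sin (((x : ℕ) : ℝ) / 2 ^ n) : ℝ) : ℂ) := QPrep.polySin_gridPoint P hab n
  have hle : ∀ t, ‖F t‖ ≤ K * QPrep.supAbs F a b := fun t =>
    hK _ ⟨Real.neg_one_le_sin _, Real.sin_le_one _⟩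
  have hFb : BddAbove ((fun t => ‖F t‖) '' Set.Icc a b) :=
    ⟨_, by rintro _ ⟨t, -, rfl⟩; exact hle t⟩
  have hffpos : 0 < QPrep.fillFrac f a b n :=
    QPrep.fillFrac_pos hab hsup (QPrep.sum_normSq_pos hx₀)
  -- a vanishing `F` has filling fraction `0`, which would force `f` to vanish on the grid
  obtain ⟨x₁, hx₁⟩ : ∃ x : Fin (2 ^ n), F (QPrep.gridPoint a b n x) ≠ 0 := by
    by_contra! h0
    have hfill : QPrep.fillFrac F a b n = 0 := by
      simp [QPrep.fillFrac, QPrep.discNorm, h0]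
    have := h x₀
    rw [← hval, h0, hfill, min_eq_right hffpos.le, mul_zero, zero_sub, norm_neg,
      norm_le_zero_iff, div_eq_zero_iff] at this
    rcases this with h1 | h1
    · exact hx₀ h1
    · exact hsup.ne' (by exact_mod_cast h1)
  have hFsum : 0 < ∑ x : Fin (2 ^ n), ‖F (QPrep.gridPoint a b n x)‖ ^ 2 := QPrep.sum_normSq_pos hx₁
  have hFsup : 0 < QPrep.supAbs F a b :=
    (norm_pos_iff.2 hx₁).trans_le (QPrep.norm_le_supAbs hFb (hgrid x₁))
  have hFfill : 0 < QPrep.fillFrac F a b n := QPrep.fillFrac_pos hab hFsup hFsum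
  refine ⟨QPrep.traceDist_stateOf_le hab hε hsup hffpos hFsum fun x => ?_, ?_⟩
  · rw [hval]
    exact (h x).trans (mul_le_mul_of_nonneg_left (min_le_left _ _) hε)
  · have hsq := QPrep.sum_normSq_eq hab hFsup n
    -- the filling fraction is at most `K`, as a root mean square is at most a maximum
    have hB : QPrep.fillFrac F a b n * QPrep.supAbs F a b ≤ K * QPrep.supAbs F a b := by
      have hKS : 0 ≤ K * QPrep.supAbs F a b := (norm_nonneg _).trans (hle a)
      refine le_of_sq_le_sq (le_of_mul_le_mul_left ?_ (by positivity : (0 : ℝ) < 2 ^ n)) hKS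
      rw [← hsq]
      calc ∑ x : Fin (2 ^ n), ‖F (QPrep.gridPoint a b n x)‖ ^ 2
          ≤ ∑ _x : Fin (2 ^ n), (K * QPrep.supAbs F a b) ^ 2 :=
            Finset.sum_le_sum fun x _ => pow_le_pow_left₀ (norm_nonneg _) (hle _) 2
        _ = 2 ^ n * (K * QPrep.supAbs F a b) ^ 2 := by simp
    obtain ⟨c, hrun, hlen⟩ := QPrep.exists_preparation hn hd hP (mul_pos hFfill hFsup) hB hK (by
      rw [← hsq]; simp only [hval])
    have hstate : (fun x : Fin (2 ^ n) => P.eval ((Real.sin (((x : ℕ) : ℝ) / 2 ^ n) : ℝ) : ℂ) /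
        ((√(2 ^ n * (QPrep.fillFrac F a b n * QPrep.supAbs F a b) ^ 2) : ℝ) : ℂ)) =
        QPrep.stateOf F a b n := by
      funext x
      rw [← hsq, QPrep.stateOf, hval]
    rw [hstate] at hrun
    refine ⟨c, hrun, hlen.trans (le_of_eq ?_)⟩
    rw [mul_div_mul_right _ _ hFsup.ne']
    ring
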